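/- All graphs are finite and simple, not necessarily connected. For a graph $G=(V,E)$ and $A\subseteq V$ let $N(A)=\{v\in V\setminus A : v \text{ is adjacent to some vertex of } A\}$ and $N[A]=A\cup N(A)$, and let $G[X]$ be the subgraph induced by $X\subseteq V$. A stable set is a set of pairwise non-adjacent vertices; $\alpha(G)$ is the maximum size of a stable set and $\mu(G)$ is the maximum size of a matching of $G$. A set $A\subseteq V$ is a local maximum stable set of $G$ if $A$ is a stable set of maximum size in $G[N[A]]$; $\Psi(G)$ is the family of all local maximum stable sets of $G$. A family $\mathcal F$ of subsets of $V$ is a greedoid if it is non-empty, for every non-empty $X\in\mathcal F$ there is $x\in X$ with $X\setminus\{x\}\in\mathcal F$, and for all $X,Y\in\mathcal F$ with $|X|=|Y|+1$ there is $x\in X\setminus Y$ with $Y\cup\{x\}\in\mathcal F$. A graph $G$ is König–Egerváry if $\alpha(G)+\mu(G)=|V(G)|$. A matching $M$ is uniquely restricted if $M$ is the unique perfect matching of the subgraph induced by the vertices that $M$ saturates. Theorem. Let $G$ be a graph with exactly one cycle, and let $k\ge 3$ be the length of that cycle. Then: (i) if $k=3$, then $\Psi(G)$ is a greedoid; (ii)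 if $k$ is even and $k\ge 4$, then $\Psi(G)$ is a greedoid if and only if every maximum matching of $G$ is uniquely restricted; (iii) if $k$ is odd and $k\ge 5$, then $\Psi(G)$ is a greedoid if and only if, for every $S\in\Psi(G)$, the graph $G[N[S]]$ is a König–Egerváry graph. -/

import Mathlib

namespace UnicycleGreedoid

variable {V : Type*}

section Greedoids

open Classical in
/-- `F`, a family of subsets of the finite set `V`, is the family of feasible sets of a greedoid
on `V`: it is non-empty, accessible, and has the exchange property. -/
structure IsGreedoid (F : Set (Finset V)) : Prop where
  nonempty : F.Nonempty
  accessible : ∀ X ∈ F, X.Nonempty → ∃ x ∈ X, X.erase x ∈ F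
  exchange : ∀ X ∈ F, ∀ Y ∈ F, X.card = Y.card + 1 → ∃ x ∈ X \ Y, insert x Y ∈ F

end Greedoids

/-- The (open) neighborhood `N(A)` of a set `A` of vertices: the vertices outside `A` that have a
neighbor in `A`. -/
def nbhd (G : SimpleGraph V) (A : Set V) : Set V :=
  {v | v ∉ A ∧ (G.neighborSet v ∩ A).Nonempty}

/-- The closed neighborhood `N[A] = A ∪ N(A)`. -/
def closedNbhd (G : SimpleGraph V) (A : Set V) : Set V :=
  A ∪ nbhd G A

open Classical in
/-- `A` is a local maximum stable set of `G`: it is a maximum stable set of the induced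
subgraph `G[N[A]]`. -/
def IsLocalMaxStable [Finite V] (G : SimpleGraph V) (A : Finset V) : Prop :=
  (G.induce (closedNbhd G (A : Set V))).IsMaximumIndepSet
    (A.subtype (· ∈ closedNbhd G (A : Set V)))

/-- The family `Ψ(G)` of all local maximum stable sets of `G`. -/
def localMaxStableSets [Finite V] (G : SimpleGraph V) : Set (Finset V) :=
  {A | IsLocalMaxStable G A}

/-- A maximum matching: a matching with the largest number of edges. (A matching in the sense of
`SimpleGraph.Subgraph.IsMatching` is given by its edges, and its vertices are exactly the
saturated ones.) -/
def IsMaximumMatching {G : SimpleGraph V} (M : G.Subgraph) : Prop :=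
  M.IsMatching ∧ ∀ M' : G.Subgraph, M'.IsMatching → M'.edgeSet.ncard ≤ M.edgeSet.ncard

/-- The size `μ(G)` of a maximum matching of the finite graph `G`. -/
noncomputable def matchingNum [Finite V] (G : SimpleGraph V) : ℕ :=
  sSup {n | ∃ M : G.Subgraph, M.IsMatching ∧ M.edgeSet.ncard = n}

/-- `G` is a König–Egerváry graph: `α(G) + μ(G) = |V(G)|`. -/
def IsKonigEgervary [Finite V] (G : SimpleGraph V) : Prop :=
  G.indepNum + matchingNum G = Nat.card V

/-- `M` is the unique perfect matching of `H`. -/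
def IsUniquePerfectMatching {H : SimpleGraph V} (M : H.Subgraph) : Prop :=
  M.IsPerfectMatching ∧ ∀ M' : H.Subgraph, M'.IsPerfectMatching → M' = M

/-- A matching `M` of `G` is uniquely restricted if `M`, seen inside the subgraph of `G` induced
by the vertices that `M` saturates, is the unique perfect matching of that induced subgraph. -/
def IsUniquelyRestricted {G : SimpleGraph V} (M : G.Subgraph) : Prop :=
  M.IsMatching ∧
    IsUniquePerfectMatching (M.comap (SimpleGraph.Embedding.induce (G := G) M.verts).toHom)

/-- The subgraph `C` of `G` is a cycle: it consists of the vertices and edges of a cyclic walk. -/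
def IsCycleSubgraph {G : SimpleGraph V} (C : G.Subgraph) : Prop :=
  ∃ (v : V) (c : G.Walk v v), c.IsCycle ∧ c.toSubgraph = C

/-- `C` is the unique cycle of `G`. -/
def IsUniqueCycle {G : SimpleGraph V} (C : G.Subgraph) : Prop :=
  IsCycleSubgraph C ∧ ∀ C' : G.Subgraph, IsCycleSubgraph C' → C' = C

end UnicycleGreedoid

/-!
For a stable set `X`, exchanging a stable set `W ⊆ N(X)` for its neighbors in `X` shows that `X` is a
local maximum stable set if and only if every stable `W ⊆ N(X)` has at least `|W|` neighbors in `X`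
(`isLocalMaxStable_iff_hall`). For the family of these sets the exchange property of greedoids
follows from accessibility (`isGreedoid_of_accessible`), so the question is when a vertex can be
removed from each nonempty member.

Call `X` inaccessible if no vertex of `X` can be removed. Then every `x ∈ X` has a stable set
`W ⊆ N(X)` that is tight (it has exactly `|W|` neighbors in `X`, one of them `x`) and contains no leaf
attached to `x`, that is, no vertex whose only neighbor in `X` is `x`
(`exists_tight_of_erase_not_mem`). If a tight set has no leaves at all, a matching of it into `X` can be
rotated to a second matching with the same range (`exists_alternating`), and the two matchings
form an even cycle. If it has a leaf `w`, attached to `x'`, then adding `w` to the tight set of `x'`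
violates Hall's condition, which is impossible when the larger set is stable or when Hall's condition
holds for all of `N(X)` (`HallNbhd`).

* For an even cycle the graph is bipartite, so `HallNbhd` always holds. The two matchings of `N(X)`
  obtained from an inaccessible `X` extend to two maximum matchings with the same vertices.
  Conversely, along the construction of an accessible set the neighborhoods determine a maximum
  matching edge by edge (`matching_eq_of_accessible`).
* For an odd cycle, `HallNbhd G X` says that `G[N[X]]` is König–Egerváry
  (`isKonigEgervary_induce_iff`). It excludes inaccessibility as there is no even cycle; conversely, it
  follows from accessibility in triangle-free graphs (`hallNbhd_of_accessible`).
* For a triangle, the enlarged set can fail to be stable only because `w` is adjacent to a member of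
  the tight set of `x'`. This puts `x'` on the triangle as its only vertex in `X`. Repeating the
  argument with `x'` in place of `x` gives a different vertex with the same property, a contradiction.
-/

namespace UnicycleGreedoid

/-! ### Local maximum stable sets -/

section LocalMaximumStableSets

open scoped Classical

variable {V : Type*} {G : SimpleGraph V}

lemma mem_nbhd {A : Set V} {v : V} : v ∈ nbhd G A ↔ v ∉ A ∧ ∃ a ∈ A, G.Adj v a := by
  constructor
  · rintro ⟨h, a, h1, h2⟩
    exact ⟨h, a, h2, h1⟩
  · rintro ⟨h, a, h1, h2⟩
    exact ⟨h, a, h2, h1⟩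

lemma mem_closedNbhd {A : Set V} {v : V} :
    v ∈ closedNbhd G A ↔ v ∈ A ∨ ∃ a ∈ A, G.Adj v a := by
  unfold closedNbhd
  rw [Set.mem_union, mem_nbhd]
  tauto

lemma isIndepSet_iff_forall_not_adj {A : Set V} :
    G.IsIndepSet A ↔ ∀ a ∈ A, ∀ b ∈ A, ¬ G.Adj a b := by
  constructor
  · intro h a ha b hb hab
    exact h ha hb hab.ne hab
  · intro h a ha b hb _
    exact h a ha b hb

lemma isIndepSet_mono {A B : Set V} (h : G.IsIndepSet B) (hAB : A ⊆ B) : G.IsIndepSet A :=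
  Set.Pairwise.mono hAB h

/-- The neighbors of `W` that lie in `X`. -/
noncomputable def nbrIn (G : SimpleGraph V) (X W : Finset V) : Finset V :=
  X.filter fun x => ∃ w ∈ W, G.Adj w x

lemma mem_nbrIn {X W : Finset V} {x : V} :
    x ∈ nbrIn G X W ↔ x ∈ X ∧ ∃ w ∈ W, G.Adj w x := by
  simp [nbrIn]

lemma isLocalMaxStable_iff [Finite V] {A : Finset V} :
    IsLocalMaxStable G A ↔ G.IsIndepSet (A : Set V) ∧
      ∀ S : Finset V, G.IsIndepSet (S : Set V) → (S : Set V) ⊆ closedNbhd G (A : Set V) →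
        S.card ≤ A.card := by
  have hA : ∀ a ∈ A, a ∈ closedNbhd G (A : Set V) := fun a ha => Or.inl (by simpa using ha)
  have hcard : (A.subtype (· ∈ closedNbhd G (A : Set V))).card = A.card := by
    rw [Finset.card_subtype, Finset.filter_true_of_mem hA]
  unfold IsLocalMaxStable
  rw [SimpleGraph.isMaximumIndepSet_iff, hcard]
  refine and_congr ?_ ?_
  · simp only [isIndepSet_iff_forall_not_adj]
    constructor
    · intro h a ha b hb hab
      exact h ⟨a, hA a ha⟩ (by simpa using ha) ⟨b, hA b hb⟩ (by simpa using hb) hab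
    · intro h a ha b hb hab
      exact h a (by simpa using ha) b (by simpa using hb) hab
  · constructor
    · intro h S hS hSA
      have h1 : (S.subtype (· ∈ closedNbhd G (A : Set V))).card = S.card := by
        rw [Finset.card_subtype, Finset.filter_true_of_mem (fun s hs => hSA hs)]
      rw [← h1]
      refine h _ ?_
      rw [isIndepSet_iff_forall_not_adj] at hS ⊢
      intro a ha b hb hab
      exact hS a (by simpa using ha) b (by simpa using hb) hab
    · intro h t ht
      have h1 : (t.map (Function.Embedding.subtype _)).card = t.card := Finset.card_map _
      rw [← h1]
      refine h _ ?_ ?_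
      · rw [isIndepSet_iff_forall_not_adj] at ht ⊢
        intro a ha b hb hab
        simp only [Finset.coe_map, Set.mem_image, Function.Embedding.subtype_apply] at ha hb
        obtain ⟨a, ha, rfl⟩ := ha
        obtain ⟨b, hb, rfl⟩ := hb
        exact ht a ha b hb hab
      · intro a ha
        simp only [Finset.coe_map, Set.mem_image, Function.Embedding.subtype_apply] at ha
        obtain ⟨a, ha, rfl⟩ := ha
        exact a.2

/-- Hall-type description of local maximum stable sets: a stable `W ⊆ N(A)` may be exchanged for
its neighbors in `A`, so it cannot outnumber them. -/
lemma isLocalMaxStable_iff_hall [Finite V] {A : Finset V} :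
    IsLocalMaxStable G A ↔ G.IsIndepSet (A : Set V) ∧
      ∀ W : Finset V, G.IsIndepSet (W : Set V) → (W : Set V) ⊆ nbhd G (A : Set V) →
        W.card ≤ (nbrIn G A W).card := by
  rw [isLocalMaxStable_iff]
  refine and_congr_right fun hA => ?_
  rw [isIndepSet_iff_forall_not_adj] at hA
  constructor
  · intro h W hW hWA
    rw [isIndepSet_iff_forall_not_adj] at hW
    have hd : Disjoint W (A \ nbrIn G A W) := by
      rw [Finset.disjoint_left]
      intro a ha ha'
      exact (hWA ha).1 (by simpa using (Finset.mem_sdiff.1 ha').1)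
    have h1 := h (W ∪ (A \ nbrIn G A W)) ?_ ?_
    · rw [Finset.card_union_of_disjoint hd] at h1
      have h2 : nbrIn G A W ⊆ A := Finset.filter_subset _ _
      have h3 := Finset.card_sdiff_add_card_eq_card h2
      omega
    · rw [isIndepSet_iff_forall_not_adj]
      intro a ha b hb hab
      simp only [Finset.coe_union, Set.mem_union, Finset.mem_coe, Finset.mem_sdiff, mem_nbrIn]
        at ha hb
      rcases ha with ha | ha <;> rcases hb with hb | hb
      · exact hW a ha b hb hab
      · exact hb.2 ⟨hb.1, a, ha, hab⟩
      · exact ha.2 ⟨ha.1, b, hb, hab.symm⟩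
      · exact hA a ha.1 b hb.1 hab
    · intro a ha
      simp only [Finset.coe_union, Set.mem_union, Finset.mem_coe, Finset.mem_sdiff] at ha
      rcases ha with ha | ha
      · exact Or.inr (hWA ha)
      · exact Or.inl ha.1
  · intro h S hS hSA
    rw [isIndepSet_iff_forall_not_adj] at hS
    have h1 := h (S \ A) ?_ ?_
    · have h2 : nbrIn G A (S \ A) ⊆ A \ S := by
        intro x hx
        rw [mem_nbrIn] at hx
        obtain ⟨hx, w, hw, hwx⟩ := hx
        rw [Finset.mem_sdiff] at hw ⊢
        exact ⟨hx, fun hxS => hS w hw.1 x hxS hwx⟩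
      have h3 := Finset.card_le_card h2
      have h4 := Finset.card_sdiff_add_card_inter S A
      have h5 := Finset.card_sdiff_add_card_inter A S
      rw [Finset.inter_comm] at h5
      omega
    · rw [isIndepSet_iff_forall_not_adj]
      intro a ha b hb
      exact hS a (Finset.mem_sdiff.1 ha).1 b (Finset.mem_sdiff.1 hb).1
    · intro a ha
      have ha' := Finset.mem_sdiff.1 ha
      exact (hSA ha'.1).resolve_left ha'.2

lemma isLocalMaxStable_empty [Finite V] : IsLocalMaxStable G ∅ := by
  rw [isLocalMaxStable_iff_hall]
  refine ⟨by simp, fun W _ hW => ?_⟩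
  have : W = ∅ := by
    rw [Finset.eq_empty_iff_forall_notMem]
    intro w hw
    have := hW hw
    simp [mem_nbhd] at this
  simp [this]

/-- If an accessible family has a member `X` that is not contained in `P`, then building up `X`
element by element, some step first leaves `P`. -/
lemma exists_first_exit {F : Set (Finset V)}
    (hF : ∀ X ∈ F, X.Nonempty → ∃ x ∈ X, X.erase x ∈ F) (P : V → Prop) (X : Finset V)
    (hX : X ∈ F) (hP : ∃ x ∈ X, ¬ P x) :
    ∃ Z ∈ F, Z ⊆ X ∧ ∃ x ∈ Z, ¬ P x ∧ Z.erase x ∈ F ∧ ∀ z ∈ Z.erase x, P z := by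
  induction hn : X.card using Nat.strong_induction_on generalizing X with
  | _ n ih =>
    obtain ⟨y, hy, hyP⟩ := hP
    obtain ⟨x, hx, hxF⟩ := hF X hX ⟨y, hy⟩
    by_cases h : ∃ z ∈ X.erase x, ¬ P z
    · obtain ⟨Z, hZ, hZX, h'⟩ := ih (X.erase x).card
        (by rw [← hn]; exact Finset.card_erase_lt_of_mem hx) _ hxF h rfl
      exact ⟨Z, hZ, hZX.trans (Finset.erase_subset _ _), h'⟩
    · push Not at h
      have hxy : y = x := by
        by_contra hne
        exact hyP (h y (Finset.mem_erase.2 ⟨hne, hy⟩))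
      exact ⟨X, hX, subset_rfl, x, hx, hxy ▸ hyP, hxF, h⟩

/-- For the family of local maximum stable sets, accessibility alone makes a greedoid. For the
exchange property, let `x` be the first element in the construction of `X` that is not in `N[Y]`;
then `Y ∪ {x}` is again a local maximum stable set. -/
lemma isGreedoid_of_accessible [Finite V]
    (hacc : ∀ X ∈ localMaxStableSets G, X.Nonempty → ∃ x ∈ X, X.erase x ∈ localMaxStableSets G) :
    IsGreedoid (localMaxStableSets G) := by
  refine ⟨⟨∅, isLocalMaxStable_empty⟩, fun X hX hne => ?_, fun X hX Y hY hXY => ?_⟩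
  · obtain ⟨x, hx, h⟩ := hacc X hX hne
    exact ⟨x, hx, by convert h⟩
  have hX' := isLocalMaxStable_iff.1 hX
  have hY' := isLocalMaxStable_iff.1 hY
  have hY1 := isIndepSet_iff_forall_not_adj.1 hY'.1
  have hex : ∃ x ∈ X, ¬ x ∈ closedNbhd G (Y : Set V) := by
    by_contra! h
    have := hY'.2 X hX'.1 (fun x hx => h x hx)
    omega
  obtain ⟨Z, hZ, hZX, x, hxZ, hxY, hZx, hZY⟩ := exists_first_exit hacc _ X hX hex
  have hZ' := isLocalMaxStable_iff.1 hZ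
  have hZ1 := isIndepSet_iff_forall_not_adj.1 hZ'.1
  have hxnY : x ∉ Y := fun h => hxY (Or.inl h)
  rw [mem_closedNbhd] at hxY
  push Not at hxY
  refine ⟨x, by simp [hZX hxZ, hxnY], ?_⟩
  have hgoal : IsLocalMaxStable G (insert x Y) := by
    rw [isLocalMaxStable_iff]
    constructor
    · rw [isIndepSet_iff_forall_not_adj]
      intro a ha b hb hab
      simp only [Finset.coe_insert, Set.mem_insert_iff, Finset.mem_coe] at ha hb
      rcases ha with rfl | ha <;> rcases hb with rfl | hb
      · exact hab.ne rfl
      · exact hxY.2 b hb hab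
      · exact hxY.2 a ha hab.symm
      · exact hY1 a ha b hb hab
    · intro S hS hSY
      rw [Finset.card_insert_of_notMem hxnY]
      have hS1 := isIndepSet_iff_forall_not_adj.1 hS
      -- `S` splits into the part in `N[Z]`, of size at most `|Z|`, and a part which together with
      -- `Z \ {x}` is stable in `N[Y]`.
      set S1 := S.filter (· ∈ closedNbhd G (Z : Set V)) with hS1def
      set S2 := S.filter (· ∉ closedNbhd G (Z : Set V)) with hS2def
      have hsum : S1.card + S2.card = S.card := Finset.card_filter_add_card_filter_not _
      have h1 : S1.card ≤ Z.card := by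
        refine hZ'.2 S1 (isIndepSet_mono hS ?_) ?_
        · intro s hs; exact (Finset.mem_filter.1 hs).1
        · intro s hs; exact (Finset.mem_filter.1 hs).2
      have hS2 : ∀ s ∈ S2, s ∈ S ∧ s ∉ Z ∧ ∀ z ∈ Z, ¬ G.Adj s z := by
        intro s hs
        have := Finset.mem_filter.1 hs
        rw [mem_closedNbhd] at this
        push Not at this
        exact this
      have h2 : (S2 ∪ Z.erase x).card ≤ Y.card := by
        refine hY'.2 _ ?_ ?_
        · rw [isIndepSet_iff_forall_not_adj]
          intro a ha b hb hab
          simp only [Finset.coe_union, Set.mem_union, Finset.mem_coe] at ha hb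
          rcases ha with ha | ha <;> rcases hb with hb | hb
          · exact hS1 a (hS2 a ha).1 b (hS2 b hb).1 hab
          · exact (hS2 a ha).2.2 b (Finset.mem_of_mem_erase hb) hab
          · exact (hS2 b hb).2.2 a (Finset.mem_of_mem_erase ha) hab.symm
          · exact hZ1 a (Finset.mem_of_mem_erase ha) b (Finset.mem_of_mem_erase hb) hab
        · intro a ha
          simp only [Finset.coe_union, Set.mem_union, Finset.mem_coe] at ha
          rcases ha with ha | ha
          · have hb := hSY (hS2 a ha).1
            rw [mem_closedNbhd] at hb ⊢
            simp only [Finset.coe_insert, Set.mem_insert_iff, Finset.mem_coe,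
              exists_eq_or_imp] at hb ⊢
            rcases hb with (rfl | hb) | hb | hb
            · exact absurd hxZ (hS2 _ ha).2.1
            · exact Or.inl hb
            · exact absurd hb ((hS2 a ha).2.2 x hxZ)
            · exact Or.inr hb
          · exact hZY a ha
      have hd : Disjoint S2 (Z.erase x) := by
        rw [Finset.disjoint_left]
        intro a ha ha'
        exact (hS2 a ha).2.1 (Finset.mem_of_mem_erase ha')
      rw [Finset.card_union_of_disjoint hd, Finset.card_erase_of_mem hxZ] at h2
      have := Finset.card_pos.2 ⟨x, hxZ⟩
      omega
  change IsLocalMaxStable G _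
  convert hgoal

lemma isGreedoid_iff_accessible [Finite V] : IsGreedoid (localMaxStableSets G) ↔
    ∀ X ∈ localMaxStableSets G, X.Nonempty → ∃ x ∈ X, X.erase x ∈ localMaxStableSets G := by
  refine ⟨fun h X hX hne => ?_, isGreedoid_of_accessible⟩
  obtain ⟨x, hx, h'⟩ := h.accessible X hX hne
  exact ⟨x, hx, by convert h'⟩

end LocalMaximumStableSets

/-! ### Hall's condition for neighborhoods -/

section HallCondition

open scoped Classical

variable {V : Type*} {G : SimpleGraph V}

/-- Hall's condition for matching the whole neighborhood `N(X)` into `X`, where the subsets of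
`N(X)` need not be stable. -/
def HallNbhd (G : SimpleGraph V) (X : Finset V) : Prop :=
  ∀ W : Finset V, (W : Set V) ⊆ nbhd G (X : Set V) → W.card ≤ (nbrIn G X W).card

lemma nbrIn_union {X W W' : Finset V} : nbrIn G X (W ∪ W') = nbrIn G X W ∪ nbrIn G X W' := by
  ext x
  simp only [mem_nbrIn, Finset.mem_union]
  grind

/-- Hall's theorem for matching `D` into `X`. -/
lemma exists_injOn_of_hall {D X : Finset V}
    (h : ∀ W ⊆ D, W.card ≤ (nbrIn G X W).card) :
    ∃ f : V → V, Set.InjOn f D ∧ ∀ v ∈ D, f v ∈ X ∧ G.Adj v (f v) := by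
  have h1 := (Finset.all_card_le_biUnion_card_iff_exists_injective
    (fun v : {v // v ∈ D} => X.filter fun x => G.Adj v x)).1 ?_
  · obtain ⟨f, hf, hf'⟩ := h1
    refine ⟨fun v => if hv : v ∈ D then f ⟨v, hv⟩ else v, ?_, ?_⟩
    · intro a ha b hb hab
      simp only [Finset.mem_coe] at ha hb
      simp only [ha, hb, dif_pos] at hab
      simpa using hf hab
    · intro v hv
      simp only [hv, dif_pos]
      simpa using hf' ⟨v, hv⟩
  · intro s
    have h2 := h (s.map (Function.Embedding.subtype _)) ?_
    · rw [Finset.card_map] at h2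
      refine h2.trans (Finset.card_le_card ?_)
      intro x hx
      rw [mem_nbrIn] at hx
      obtain ⟨hx, w, hw, hwx⟩ := hx
      simp only [Finset.mem_map, Function.Embedding.subtype_apply] at hw
      obtain ⟨w, hw, rfl⟩ := hw
      simp only [Finset.mem_biUnion, Finset.mem_filter]
      exact ⟨w, hw, hx, hwx⟩
    · intro a ha
      simp only [Finset.mem_map, Function.Embedding.subtype_apply] at ha
      obtain ⟨w, hw, rfl⟩ := ha
      exact w.2

lemma card_le_card_nbrIn_of_injOn {D X W : Finset V} {f : V → V} (hf : Set.InjOn f D)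
    (hfX : ∀ v ∈ D, f v ∈ X ∧ G.Adj v (f v)) (hW : W ⊆ D) : W.card ≤ (nbrIn G X W).card := by
  rw [← Finset.card_image_of_injOn (hf.mono hW)]
  refine Finset.card_le_card fun x hx => ?_
  obtain ⟨w, hw, rfl⟩ := Finset.mem_image.1 hx
  exact mem_nbrIn.2 ⟨(hfX w (hW hw)).1, w, hw, (hfX w (hW hw)).2⟩

/-- In a bipartite graph, both color classes of a set `W ⊆ N(X)` are stable and their neighbors in
`X` are disjoint. -/
lemma hallNbhd_of_coloring [Finite V] (c : G.Coloring Bool) {X : Finset V}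
    (hX : IsLocalMaxStable G X) : HallNbhd G X := by
  intro W hW
  rw [isLocalMaxStable_iff_hall] at hX
  have key : ∀ b : Bool, (W.filter fun w => c w = b).card ≤
      (nbrIn G X (W.filter fun w => c w = b)).card := by
    intro b
    refine hX.2 _ ?_ ?_
    · rw [isIndepSet_iff_forall_not_adj]
      intro u hu v hv huv
      exact c.valid huv ((Finset.mem_filter.1 hu).2.trans (Finset.mem_filter.1 hv).2.symm)
    · intro u hu
      exact hW (Finset.mem_filter.1 hu).1
  have hun : W = (W.filter fun w => c w = true) ∪ (W.filter fun w => c w = false) := by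
    ext w
    simp only [Finset.mem_union, Finset.mem_filter]
    cases c w <;> simp
  have hd : Disjoint (W.filter fun w => c w = true) (W.filter fun w => c w = false) := by
    rw [Finset.disjoint_left]
    intro w hw hw'
    have h1 := (Finset.mem_filter.1 hw).2
    have h2 := (Finset.mem_filter.1 hw').2
    simp [h1] at h2
  have hd' : Disjoint (nbrIn G X (W.filter fun w => c w = true))
      (nbrIn G X (W.filter fun w => c w = false)) := by
    rw [Finset.disjoint_left]
    intro x hx hx'
    obtain ⟨-, u, hu, hux⟩ := mem_nbrIn.1 hx
    obtain ⟨-, v, hv, hvx⟩ := mem_nbrIn.1 hx'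
    have h1 := (Finset.mem_filter.1 hu).2
    have h2 := (Finset.mem_filter.1 hv).2
    have h3 := c.valid hux
    have h4 := c.valid hvx
    rw [h1] at h3
    rw [h2] at h4
    cases hcx : c x <;> simp [hcx] at h3 h4
  calc W.card = _ := by conv_lhs => rw [hun]
    _ = _ := Finset.card_union_of_disjoint hd
    _ ≤ _ := Nat.add_le_add (key true) (key false)
    _ = _ := (Finset.card_union_of_disjoint hd').symm
    _ = (nbrIn G X W).card := by rw [← nbrIn_union, ← hun]

/-- In a triangle-free graph whose family of local maximum stable sets is accessible, `N(X)`
satisfies Hall's condition for every member `X`. By induction along the construction of `X`: when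
`x` is added last, at most one vertex has `x` as its only neighbor in `X`, since two such vertices
are either adjacent, and form a triangle with `x`, or a stable set violating local maximality. -/
lemma hallNbhd_of_accessible [Finite V]
    (htri : ∀ a b c, G.Adj a b → G.Adj b c → G.Adj a c → False)
    (hacc : ∀ X ∈ localMaxStableSets G, X.Nonempty → ∃ x ∈ X, X.erase x ∈ localMaxStableSets G)
    (X : Finset V) (hX : IsLocalMaxStable G X) : HallNbhd G X := by
  induction hn : X.card using Nat.strong_induction_on generalizing X with
  | _ n ih =>
    intro W hW
    rcases X.eq_empty_or_nonempty with rfl | hne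
    · have : W = ∅ := by
        rw [Finset.eq_empty_iff_forall_notMem]
        intro w hw
        have := hW hw
        simp [mem_nbhd] at this
      simp [this]
    obtain ⟨x, hx, hxF⟩ := hacc X hX hne
    have hY := ih (X.erase x).card (by rw [← hn]; exact Finset.card_erase_lt_of_mem hx) _ hxF rfl
    set W0 := W.filter fun w => ∃ y ∈ X.erase x, G.Adj w y with hW0
    set L := W.filter fun w => ¬ ∃ y ∈ X.erase x, G.Adj w y with hL
    have hsum : W0.card + L.card = W.card := Finset.card_filter_add_card_filter_not _
    have hWX : ∀ w ∈ W, w ∉ X ∧ ∃ y ∈ X, G.Adj w y := by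
      intro w hw
      have := mem_nbhd.1 (hW hw)
      simpa using this
    have hLx : ∀ w ∈ L, w ∈ W ∧ G.Adj w x ∧ ∀ y ∈ X, G.Adj w y → y = x := by
      intro w hw
      obtain ⟨hwW, hw⟩ := Finset.mem_filter.1 hw
      push Not at hw
      have h1 : ∀ y ∈ X, G.Adj w y → y = x := by
        intro y hy hwy
        by_contra hne
        exact hw y (Finset.mem_erase.2 ⟨hne, hy⟩) hwy
      obtain ⟨-, y, hy, hwy⟩ := hWX w hwW
      exact ⟨hwW, h1 y hy hwy ▸ hwy, h1⟩
    have hL1 : L.card ≤ 1 := by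
      rw [Finset.card_le_one]
      intro a ha b hb
      by_contra hab
      have ha' := hLx a ha
      have hb' := hLx b hb
      have hnadj : ¬ G.Adj a b := fun h => htri a b x h hb'.2.1 ha'.2.1
      have h1 := (isLocalMaxStable_iff_hall.1 hX).2 {a, b} ?_ ?_
      · rw [Finset.card_pair hab] at h1
        have h2 : nbrIn G X {a, b} ⊆ {x} := by
          intro y hy
          rw [mem_nbrIn] at hy
          obtain ⟨hy, w, hw, hwy⟩ := hy
          simp only [Finset.mem_insert, Finset.mem_singleton] at hw ⊢
          rcases hw with rfl | rfl
          · exact ha'.2.2 y hy hwy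
          · exact hb'.2.2 y hy hwy
        have h3 := Finset.card_le_card h2
        simp only [Finset.card_singleton] at h3
        omega
      · rw [isIndepSet_iff_forall_not_adj]
        intro u hu v hv huv
        simp only [Finset.coe_insert, Finset.coe_singleton, Set.mem_insert_iff,
          Set.mem_singleton_iff] at hu hv
        rcases hu with rfl | rfl <;> rcases hv with rfl | rfl
        · exact huv.ne rfl
        · exact hnadj huv
        · exact hnadj huv.symm
        · exact huv.ne rfl
      · intro u hu
        simp only [Finset.coe_insert, Finset.coe_singleton, Set.mem_insert_iff,
          Set.mem_singleton_iff] at hu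
        rcases hu with rfl | rfl
        · exact hW ha'.1
        · exact hW hb'.1
    have hW0le : W0.card ≤ (nbrIn G (X.erase x) W0).card := by
      refine hY W0 fun w hw => ?_
      obtain ⟨hwW, hw⟩ := Finset.mem_filter.1 hw
      rw [mem_nbhd]
      refine ⟨fun h => (hWX w hwW).1 (Finset.mem_of_mem_erase h), hw⟩
    have hsub : nbrIn G (X.erase x) W0 ⊆ (nbrIn G X W).erase x := by
      intro y hy
      rw [mem_nbrIn] at hy
      obtain ⟨hy, w, hw, hwy⟩ := hy
      rw [Finset.mem_erase, mem_nbrIn]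
      exact ⟨(Finset.mem_erase.1 hy).1, (Finset.mem_erase.1 hy).2, w,
        (Finset.mem_filter.1 hw).1, hwy⟩
    have hle := Finset.card_le_card hsub
    rcases L.eq_empty_or_nonempty with hL0 | ⟨w, hw⟩
    · rw [hL0, Finset.card_empty] at hsum
      have := Finset.card_erase_le (s := nbrIn G X W) (a := x)
      omega
    · have hxn : x ∈ nbrIn G X W := mem_nbrIn.2 ⟨hx, w, (hLx w hw).1, (hLx w hw).2.1⟩
      have := Finset.card_erase_add_one hxn
      omega

end HallCondition

/-! ### Tight sets and alternating matchings -/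

section Inaccessible

open scoped Classical

variable {V : Type*} {G : SimpleGraph V}

/-- If removing `x` from a local maximum stable set `X` destroys local maximality, this is because
of a stable set `W ⊆ N(X)` which is tight, meaning that it has exactly `|W|` neighbors in `X`, one
of which is `x`, while every member of `W` has a neighbor in `X` other than `x`. Moreover, `W` can
be chosen connected to `x` by edges between `W` and `X`. -/
lemma exists_tight_of_erase_not_mem [Finite V] {X : Finset V} {x : V}
    (hX : IsLocalMaxStable G X) (hxX : x ∈ X) (hx : ¬ IsLocalMaxStable G (X.erase x)) :
    ∃ W : Finset V, G.IsIndepSet (W : Set V) ∧ (W : Set V) ⊆ nbhd G (X : Set V) ∧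
      (nbrIn G X W).card = W.card ∧ x ∈ nbrIn G X W ∧
      (∀ w ∈ W, ∃ y ∈ X, y ≠ x ∧ G.Adj w y) ∧
      ∀ w ∈ W, (G.between (W : Set V) (X : Set V)).Reachable x w := by
  have hXi := isIndepSet_iff_forall_not_adj.1 (isLocalMaxStable_iff_hall.1 hX).1
  have hXh := (isLocalMaxStable_iff_hall.1 hX).2
  have hex : ∃ W : Finset V, G.IsIndepSet (W : Set V) ∧
      (W : Set V) ⊆ nbhd G ((X.erase x : Finset V) : Set V) ∧
      (nbrIn G (X.erase x) W).card < W.card := by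
    by_contra! h
    exact hx (isLocalMaxStable_iff_hall.2 ⟨isIndepSet_mono (isLocalMaxStable_iff_hall.1 hX).1
      (by exact_mod_cast Finset.erase_subset _ _), h⟩)
  obtain ⟨W, hW, hWn, hlt⟩ := hex
  have hnbr : ∀ w ∈ W, ∃ y ∈ X, y ≠ x ∧ G.Adj w y := by
    intro w hw
    obtain ⟨-, y, hy, hwy⟩ := mem_nbhd.1 (hWn hw)
    have hy' : y ∈ X.erase x := hy
    exact ⟨y, (Finset.mem_erase.1 hy').2, (Finset.mem_erase.1 hy').1, hwy⟩
  have hWX : (W : Set V) ⊆ nbhd G (X : Set V) := by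
    intro w hw
    obtain ⟨y, hy, -, hwy⟩ := hnbr w hw
    exact mem_nbhd.2 ⟨fun h => hXi w h y hy hwy, y, hy, hwy⟩
  have hle := hXh W hW hWX
  have herase : nbrIn G (X.erase x) W = (nbrIn G X W).erase x := by
    ext y
    simp only [mem_nbrIn, Finset.mem_erase]
    tauto
  rw [herase] at hlt
  have hxW : x ∈ nbrIn G X W := by
    by_contra h
    rw [Finset.erase_eq_of_notMem h] at hlt
    omega
  have hcard : (nbrIn G X W).card = W.card := by
    have := Finset.card_erase_add_one hxW
    omega
  set H := G.between (W : Set V) (X : Set V) with hH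
  set W1 := W.filter fun w => H.Reachable x w with hW1
  set W2 := W.filter fun w => ¬ H.Reachable x w with hW2
  have hW1s : W1 ⊆ W := Finset.filter_subset _ _
  have hW2s : W2 ⊆ W := Finset.filter_subset _ _
  have hsum : W1.card + W2.card = W.card := Finset.card_filter_add_card_filter_not _
  have hun : W1 ∪ W2 = W := Finset.filter_union_filter_not_eq _ _
  have hadj : ∀ w ∈ W, ∀ y ∈ X, G.Adj w y → H.Adj w y := by
    intro w hw y hy hwy
    rw [hH, SimpleGraph.between_adj]
    exact ⟨hwy, Or.inl ⟨hw, hy⟩⟩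
  have hd : Disjoint (nbrIn G X W1) (nbrIn G X W2) := by
    rw [Finset.disjoint_left]
    intro y hy hy'
    obtain ⟨hyX, u, hu, huy⟩ := mem_nbrIn.1 hy
    obtain ⟨-, v, hv, hvy⟩ := mem_nbrIn.1 hy'
    obtain ⟨huW, hu⟩ := Finset.mem_filter.1 hu
    obtain ⟨hvW, hv⟩ := Finset.mem_filter.1 hv
    exact hv ((hu.trans (hadj u huW y hyX huy).reachable).trans
      (hadj v hvW y hyX hvy).symm.reachable)
  have h1 := hXh W1 (isIndepSet_mono hW (by exact_mod_cast hW1s)) (fun w hw => hWX (hW1s hw))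
  have h2 := hXh W2 (isIndepSet_mono hW (by exact_mod_cast hW2s)) (fun w hw => hWX (hW2s hw))
  have h3 := Finset.card_union_of_disjoint hd
  rw [← nbrIn_union, hun] at h3
  refine ⟨W1, isIndepSet_mono hW (by exact_mod_cast hW1s), fun w hw => hWX (hW1s hw), by omega,
    ?_, fun w hw => hnbr w (hW1s hw), ?_⟩
  · obtain ⟨-, w, hw, hwx⟩ := mem_nbrIn.1 hxW
    exact mem_nbrIn.2 ⟨hxX, w, Finset.mem_filter.2
      ⟨hw, (hadj w hw x hxX hwx).symm.reachable⟩, hwx⟩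
  · -- A walk from `x` in `H` only meets vertices reachable from `x`.
    have hwalk : ∀ u v (p : H.Walk u v), H.Reachable x u →
        (G.between (W1 : Set V) (X : Set V)).Reachable u v := by
      intro u v p
      induction p with
      | nil => intro _; exact SimpleGraph.Reachable.refl _
      | cons h p ih =>
        intro hu
        have hv := hu.trans h.reachable
        refine SimpleGraph.Reachable.trans (SimpleGraph.Adj.reachable ?_) (ih hv)
        rw [hH, SimpleGraph.between_adj] at h
        rw [SimpleGraph.between_adj]
        refine ⟨h.1, h.2.imp ?_ ?_⟩
        · rintro ⟨h1, h2⟩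
          exact ⟨Finset.mem_filter.2 ⟨h1, hu⟩, h2⟩
        · rintro ⟨h1, h2⟩
          exact ⟨h1, Finset.mem_filter.2 ⟨h2, hv⟩⟩
    intro w hw
    obtain ⟨p⟩ := (Finset.mem_filter.1 hw).2
    exact hwalk _ _ p (SimpleGraph.Reachable.refl _)

/-- A tight set without leaves admits two different matchings with the same range. Given a
matching `f`, let `h` send `w` to the vertex whose `f`-partner is another neighbor of `w`; rotating
`f` along the cycles of `h` gives the second one. -/
lemma exists_alternating {W X D : Finset V} {f : V → V} (hf : Set.InjOn f D) (hWD : W ⊆ D)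
    (hfX : ∀ w ∈ D, f w ∈ X ∧ G.Adj w (f w)) (htight : (nbrIn G X W).card = W.card)
    (hdeg : ∀ w ∈ W, ∀ x ∈ X, G.Adj w x → ∃ y ∈ X, y ≠ x ∧ G.Adj w y) (hne : W.Nonempty) :
    ∃ f' : V → V, Set.InjOn f' D ∧ (∀ w ∈ D, f' w ∈ X ∧ G.Adj w (f' w)) ∧
      D.image f' = D.image f ∧ ∃ w ∈ D, f w ≠ f' w := by
  have himg : W.image f = nbrIn G X W := by
    refine Finset.eq_of_subset_of_card_le ?_ ?_
    · intro x hx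
      obtain ⟨w, hw, rfl⟩ := Finset.mem_image.1 hx
      exact mem_nbrIn.2 ⟨(hfX w (hWD hw)).1, w, hw, (hfX w (hWD hw)).2⟩
    · rw [htight, Finset.card_image_of_injOn (hf.mono (by exact_mod_cast hWD))]
  have hstep : ∀ w : {w // w ∈ W}, ∃ u : {w // w ∈ W}, f u ≠ f w ∧ G.Adj w (f u) := by
    rintro ⟨w, hw⟩
    obtain ⟨y, hy, hyw, hwy⟩ := hdeg w hw (f w) (hfX w (hWD hw)).1 (hfX w (hWD hw)).2
    have : y ∈ W.image f := by
      rw [himg]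
      exact mem_nbrIn.2 ⟨hy, w, hw, hwy⟩
    obtain ⟨u, hu, rfl⟩ := Finset.mem_image.1 this
    exact ⟨⟨u, hu⟩, hyw, hwy⟩
  choose h hh1 hh2 using hstep
  set P := Function.periodicPts h with hP
  have hPbij : Set.BijOn h P P := Function.bijOn_periodicPts h
  obtain ⟨p, hp⟩ : ∃ p, p ∈ P := by
    obtain ⟨w, hw⟩ := hne
    obtain ⟨m, n, hmn, heq⟩ := Finite.exists_ne_map_eq_of_infinite (fun n => h^[n] ⟨w, hw⟩)
    wlog hlt : m < n generalizing m n
    · exact this n m hmn.symm heq.symm (by omega)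
    refine ⟨h^[m] ⟨w, hw⟩, n - m, by omega, ?_⟩
    change h^[n - m] (h^[m] ⟨w, hw⟩) = h^[m] ⟨w, hw⟩
    rw [← Function.iterate_add_apply, Nat.sub_add_cancel hlt.le]
    exact heq.symm
  -- `g` moves the periodic points along `h` and fixes everything else
  let g : V → V := fun v => if hv : ∃ hw : v ∈ W, (⟨v, hw⟩ : {w // w ∈ W}) ∈ P
    then (h ⟨v, hv.1⟩ : V) else v
  have hg1 : ∀ q : {w // w ∈ W}, q ∈ P → g q = h q := by
    intro q hq
    have : ∃ hw : (q : V) ∈ W, (⟨q, hw⟩ : {w // w ∈ W}) ∈ P := ⟨q.2, hq⟩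
    simp only [g, dif_pos this]
  have hg2 : ∀ v, (∀ q ∈ P, (q : V) ≠ v) → g v = v := by
    intro v hv
    have : ¬ ∃ hw : v ∈ W, (⟨v, hw⟩ : {w // w ∈ W}) ∈ P := fun ⟨hw, h'⟩ => hv _ h' rfl
    simp only [g, dif_neg this]
  have hcase : ∀ v, (∃ q ∈ P, (q : V) = v) ∨ ∀ q ∈ P, (q : V) ≠ v := by
    intro v
    by_cases hv : ∃ q ∈ P, (q : V) = v
    · exact Or.inl hv
    · push Not at hv
      exact Or.inr hv
  have hgD : ∀ v ∈ D, g v ∈ D := by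
    intro v hv
    rcases hcase v with ⟨q, hq, rfl⟩ | hq
    · rw [hg1 q hq]
      exact hWD (h q).2
    · rw [hg2 v hq]
      exact hv
  have hgsurj : ∀ v ∈ D, ∃ u ∈ D, g u = v := by
    intro v hv
    rcases hcase v with ⟨q, hq, rfl⟩ | hq
    · obtain ⟨r, hr, rfl⟩ := hPbij.surjOn hq
      exact ⟨r, hWD r.2, hg1 r hr⟩
    · exact ⟨v, hv, hg2 v hq⟩
  have hgimg : D.image g = D := by
    ext v
    rw [Finset.mem_image]
    constructor
    · rintro ⟨u, hu, rfl⟩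
      exact hgD u hu
    · exact hgsurj v
  have hginj : Set.InjOn g D := by
    rw [← Finset.card_image_iff, hgimg]
  refine ⟨f ∘ g, hf.comp hginj (fun v hv => hgD v hv), ?_, ?_, p, hWD p.2, ?_⟩
  · intro v hv
    refine ⟨(hfX _ (hgD v hv)).1, ?_⟩
    rcases hcase v with ⟨q, hq, rfl⟩ | hq
    · simp only [Function.comp_apply, hg1 q hq]
      exact hh2 q
    · simp only [Function.comp_apply, hg2 v hq]
      exact (hfX v hv).2
  · rw [← Finset.image_image, hgimg]
  · simp only [Function.comp_apply, hg1 p hp]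
    exact (hh1 p).symm

/-- Adding a leaf `w` attached to `x` to a set that has the neighbor `x` does not enlarge the set of
neighbors. -/
lemma nbrIn_insert_leaf {X W : Finset V} {x w : V} (hxW : x ∈ nbrIn G X W)
    (hnbr : ∀ w ∈ W, ∃ y ∈ X, y ≠ x ∧ G.Adj w y) (hleaf : ∀ y ∈ X, y ≠ x → ¬ G.Adj w y) :
    w ∉ W ∧ nbrIn G X (insert w W) ⊆ nbrIn G X W := by
  constructor
  · intro h
    obtain ⟨y, hy, hyx, hwy⟩ := hnbr w h
    exact hleaf y hy hyx hwy
  · intro y hy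
    rw [mem_nbrIn] at hy
    obtain ⟨hy, u, hu, huy⟩ := hy
    rw [Finset.mem_insert] at hu
    rcases hu with rfl | hu
    · by_cases hyx : y = x
      · exact hyx ▸ hxW
      · exact absurd huy (hleaf y hy hyx)
    · exact mem_nbrIn.2 ⟨hy, u, hu, huy⟩

/-- A nonempty local maximum stable set `X` that satisfies the full Hall condition and from which
no vertex can be removed has two different matchings of `N(X)` with the same range in `X`: a leaf
`w` in a tight set, attached to `x'`, could be added to the tight set belonging to `x'`,
against Hall's condition. -/
lemma exists_two_matchings_of_inaccessible [Finite V] {X D : Finset V}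
    (hX : IsLocalMaxStable G X) (hne : X.Nonempty)
    (hbad : ∀ x ∈ X, ¬ IsLocalMaxStable G (X.erase x)) (hhall : HallNbhd G X)
    (hD : (D : Set V) = nbhd G (X : Set V)) :
    ∃ f f' : V → V, Set.InjOn f D ∧ Set.InjOn f' D ∧ (∀ w ∈ D, f w ∈ X ∧ G.Adj w (f w)) ∧
      (∀ w ∈ D, f' w ∈ X ∧ G.Adj w (f' w)) ∧ D.image f' = D.image f ∧ ∃ w ∈ D, f w ≠ f' w := by
  obtain ⟨f, hf, hfX⟩ := exists_injOn_of_hall (G := G) (D := D) (X := X)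
    (fun W hW => hhall W (by rw [← hD]; exact_mod_cast hW))
  obtain ⟨x, hx⟩ := hne
  obtain ⟨W, -, hWX, hcard, hxW, -, -⟩ := exists_tight_of_erase_not_mem hX hx (hbad x hx)
  have hdeg : ∀ w ∈ W, ∀ x' ∈ X, G.Adj w x' → ∃ y ∈ X, y ≠ x' ∧ G.Adj w y := by
    intro w hw x' hx' hwx'
    by_contra! hleaf
    obtain ⟨W', -, hWX', hcard', hxW', hnbr', -⟩ :=
      exists_tight_of_erase_not_mem hX hx' (hbad x' hx')
    obtain ⟨hwW', hsub⟩ := nbrIn_insert_leaf hxW' hnbr' hleaf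
    have hle := hhall (insert w W') ?_
    · have := Finset.card_le_card hsub
      rw [Finset.card_insert_of_notMem hwW'] at hle
      omega
    · intro u hu
      simp only [Finset.coe_insert, Set.mem_insert_iff, Finset.mem_coe] at hu
      rcases hu with rfl | hu
      · exact hWX hw
      · exact hWX' hu
  have hWne : W.Nonempty := by
    obtain ⟨-, w, hw, -⟩ := mem_nbrIn.1 hxW
    exact ⟨w, hw⟩
  have hWD : W ⊆ D := by
    rw [← Finset.coe_subset, hD]
    exact hWX
  obtain ⟨f', h1, h2, h3, h4⟩ := exists_alternating hf hWD hfX hcard hdeg hWne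
  exact ⟨f, f', hf, h1, hfX, h2, h3, h4⟩

end Inaccessible

/-! ### Cycles in unicyclic graphs -/

section Cycles

variable {V : Type*} {G : SimpleGraph V}

lemma ncard_verts_toSubgraph_of_isCycle {v : V} {c : G.Walk v v} (hc : c.IsCycle) :
    c.toSubgraph.verts.ncard = c.length := by
  classical
  have h1 : c.toSubgraph.verts = (c.support.tail.toFinset : Set V) := by
    ext x
    rw [SimpleGraph.Walk.verts_toSubgraph, Set.mem_ofPred, Finset.mem_coe, List.mem_toFinset,
      ← SimpleGraph.Walk.cons_tail_support, List.mem_cons]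
    constructor
    · rintro (rfl | h)
      · exact SimpleGraph.Walk.end_mem_tail_support hc.not_nil
      · exact h
    · exact Or.inr
  rw [h1, Set.ncard_coe_finset, List.toFinset_card_of_nodup hc.support_nodup]
  simp

lemma IsUniqueCycle.toSubgraph_eq {C : G.Subgraph} (hC : IsUniqueCycle C) {v : V}
    {c : G.Walk v v} (hc : c.IsCycle) : c.toSubgraph = C :=
  hC.2 _ ⟨v, c, hc, rfl⟩

lemma IsUniqueCycle.length_eq {C : G.Subgraph} (hC : IsUniqueCycle C) {v : V}
    {c : G.Walk v v} (hc : c.IsCycle) : c.length = C.verts.ncard := by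
  rw [← ncard_verts_toSubgraph_of_isCycle hc, hC.toSubgraph_eq hc]

lemma IsUniqueCycle.triangle_free {C : G.Subgraph} (hC : IsUniqueCycle C)
    (h3 : C.verts.ncard ≠ 3) (a b c : V) (hab : G.Adj a b) (hbc : G.Adj b c) (hac : G.Adj a c) :
    False := by
  have hcyc : (SimpleGraph.Walk.cons hab (SimpleGraph.Walk.cons hbc
      (SimpleGraph.Walk.cons hac.symm SimpleGraph.Walk.nil))).IsCycle := by
    rw [SimpleGraph.Walk.cons_isCycle_iff]
    have h1 := hab.ne
    have h2 := hbc.ne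
    have h3 := hac.ne
    constructor
    · simp [SimpleGraph.Walk.cons_isPath_iff, h2, h1.symm, h3.symm]
    · simp [h1, h1.symm, h2, h3]
  have := hC.length_eq hcyc
  simp at this
  omega

/-- A graph whose only cycle is even is bipartite: removing an edge of the cycle leaves a forest,
in which the ends of the removed edge are joined by a path of odd length. -/
lemma IsUniqueCycle.nonempty_coloring {C : G.Subgraph} (hC : IsUniqueCycle C)
    (heven : Even C.verts.ncard) : Nonempty (G.Coloring Bool) := by
  obtain ⟨v, c, hc, hcC⟩ := hC.1
  have hlen := hC.length_eq hc
  cases c with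
  | nil => simp at hc
  | @cons _ u _ h p =>
    obtain ⟨hp, hnot⟩ := (SimpleGraph.Walk.cons_isCycle_iff _ _).1 hc
    have hacyc : (G.deleteEdges {s(v, u)}).IsAcyclic := by
      intro a d hd
      have hle : G.deleteEdges {s(v, u)} ≤ G := SimpleGraph.deleteEdges_le _
      have h1 := hC.toSubgraph_eq (hd.mapLe hle)
      have h2 : s(v, u) ∈ (d.mapLe hle).edges := by
        rw [← SimpleGraph.Walk.mem_edges_toSubgraph, h1, ← hcC,
          SimpleGraph.Walk.mem_edges_toSubgraph]
        simp
      rw [SimpleGraph.Walk.edges_mapLe_eq_edges] at h2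
      have h3 := d.edges_subset_edgeSet h2
      simp at h3
    let col := hacyc.colorable_two.toColoring (α := Bool) (by simp)
    have hp' : ∀ e ∈ p.edges, e ∈ (G.deleteEdges {s(v, u)}).edgeSet := by
      intro e he
      rw [SimpleGraph.edgeSet_deleteEdges]
      refine ⟨p.edges_subset_edgeSet he, ?_⟩
      rintro rfl
      exact hnot he
    have hodd : ¬ Even (p.transfer _ hp').length := by
      rw [SimpleGraph.Walk.length_transfer]
      rw [SimpleGraph.Walk.length_cons] at hlen
      rw [← hlen, Nat.even_add_one] at heven
      exact heven
    rw [col.even_length_iff_congr] at hodd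
    have huv : col u ≠ col v := fun h => hodd (by rw [h])
    refine ⟨SimpleGraph.Coloring.mk col ?_⟩
    intro a b hab
    by_cases he : s(a, b) = s(v, u)
    · rw [Sym2.eq_iff] at he
      rcases he with ⟨rfl, rfl⟩ | ⟨rfl, rfl⟩
      · exact huv.symm
      · exact huv
    · refine col.valid ?_
      rw [SimpleGraph.deleteEdges_adj]
      exact ⟨hab, he⟩

/-- A finite graph with an edge in which no vertex has degree one contains a cycle: a longest path
cannot be extended beyond its end. -/
lemma not_isAcyclic_of_exists_other_adj [Finite V] {a b : V} (hab : G.Adj a b)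
    (h : ∀ v w, G.Adj v w → ∃ w', w' ≠ w ∧ G.Adj v w') : ¬ G.IsAcyclic := by
  intro hac
  have : Nonempty V := ⟨a⟩
  obtain ⟨u, v, p, hp, hmax⟩ := SimpleGraph.Walk.exists_isPath_forall_isPath_length_le_length G
  have h1 : 1 ≤ p.length := by
    have := hmax a b hab.toWalk (by
      simp [SimpleGraph.Walk.cons_isPath_iff, hab.ne])
    simpa using this
  have hnil : ¬ p.Nil := by
    rw [← SimpleGraph.Walk.length_eq_zero_iff]
    omega
  obtain ⟨w, hw, hvw⟩ := h v p.penultimate (p.adj_penultimate hnil).symm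
  refine hw (hac.eq_penultimate_of_adj_end hp hvw ?_)
  by_contra hws
  have := hmax u w (p.concat hvw) (hp.concat hws hvw)
  rw [SimpleGraph.Walk.length_concat] at this
  omega

/-- Two different matchings of `D` into `X` with the same range give an even cycle. -/
lemma exists_even_cycle_of_two_matchings [Finite V] [DecidableEq V] {D X : Finset V} {f f' : V → V}
    (hdisj : Disjoint D X) (hf : Set.InjOn f D) (hf' : Set.InjOn f' D)
    (hfX : ∀ w ∈ D, f w ∈ X ∧ G.Adj w (f w)) (hfX' : ∀ w ∈ D, f' w ∈ X ∧ G.Adj w (f' w))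
    (himg : D.image f' = D.image f) (hne : ∃ w ∈ D, f w ≠ f' w) :
    ∃ (v : V) (c : G.Walk v v), c.IsCycle ∧ Even c.length := by
  -- the edges that belong to exactly one of the two matchings
  let r : V → V → Prop := fun a b => a ∈ D ∧ f a ≠ f' a ∧ (b = f a ∨ b = f' a)
  have hrX : ∀ a b, r a b → a ∈ D ∧ b ∈ X ∧ G.Adj a b := by
    rintro a b ⟨ha, -, rfl | rfl⟩
    · exact ⟨ha, hfX a ha⟩
    · exact ⟨ha, hfX' a ha⟩
  let H : SimpleGraph V :=
    { Adj := fun a b => r a b ∨ r b a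
      symm := ⟨fun a b h => h.symm⟩
      loopless := ⟨fun a h => by
        have := h.elim (hrX a a) (hrX a a)
        exact this.2.2.ne rfl⟩ }
  have hHG : H ≤ G := by
    intro a b h
    rcases h with h | h
    · exact (hrX a b h).2.2
    · exact (hrX b a h).2.2.symm
  have hother : ∀ v w, H.Adj v w → ∃ w', w' ≠ w ∧ H.Adj v w' := by
    intro v w h
    rcases h with ⟨hv, hff, rfl | rfl⟩ | ⟨hw, hff, rfl | rfl⟩
    · exact ⟨f' v, hff.symm, Or.inl ⟨hv, hff, Or.inr rfl⟩⟩
    · exact ⟨f v, hff, Or.inl ⟨hv, hff, Or.inl rfl⟩⟩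
    · have hmem : f w ∈ D.image f' := by
        rw [himg]
        exact Finset.mem_image_of_mem f hw
      obtain ⟨w', hw', heq⟩ := Finset.mem_image.1 hmem
      have hww : w' ≠ w := by
        rintro rfl
        exact hff heq.symm
      refine ⟨w', hww, Or.inr ⟨hw', ?_, Or.inr heq.symm⟩⟩
      intro h
      exact hww (hf hw' hw (h.trans heq))
    · have hmem : f' w ∈ D.image f := by
        rw [← himg]
        exact Finset.mem_image_of_mem f' hw
      obtain ⟨w', hw', heq⟩ := Finset.mem_image.1 hmem
      have hww : w' ≠ w := by
        rintro rfl
        exact hff heq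
      refine ⟨w', hww, Or.inr ⟨hw', ?_, Or.inl heq.symm⟩⟩
      intro h
      exact hww (hf' hw' hw (h.symm.trans heq))
  obtain ⟨w, hw, hww⟩ := hne
  have hacyc := not_isAcyclic_of_exists_other_adj
    (show H.Adj w (f w) from Or.inl ⟨hw, hww, Or.inl rfl⟩) hother
  unfold SimpleGraph.IsAcyclic at hacyc
  push Not at hacyc
  obtain ⟨v, c, hc⟩ := hacyc
  refine ⟨v, c.mapLe hHG, hc.mapLe hHG, ?_⟩
  have hXD : ∀ a ∈ D, a ∉ X := fun a ha ha' => Finset.disjoint_left.1 hdisj ha ha'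
  let col : H.Coloring Bool := SimpleGraph.Coloring.mk (fun v => decide (v ∈ X)) (by
    intro a b h
    rcases h with h | h
    · have := hrX a b h
      simp [hXD a this.1, this.2.1]
    · have := hrX b a h
      simp [hXD b this.1, this.2.1])
  have := (col.even_length_iff_congr c).2 Iff.rfl
  simpa using this

/-- If `x ∈ X` is joined to `u ∈ W` by a path alternating between `X` and `W`, and `w` outside
`W ∪ X` is adjacent to both, then the cycle passes through all three. -/
lemma IsUniqueCycle.mem_verts_of_reachable {C : G.Subgraph} (hC : IsUniqueCycle C)
    {W X : Set V} {x u w : V} (hx : x ∈ X) (hu : u ∉ X) (hwW : w ∉ W) (hwX : w ∉ X)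
    (hwx : G.Adj w x) (hwu : G.Adj w u) (hr : (G.between W X).Reachable x u) :
    x ∈ C.verts ∧ w ∈ C.verts ∧ u ∈ C.verts := by
  obtain ⟨p, hp⟩ := hr.exists_isPath
  have hsupp : ∀ a b (q : (G.between W X).Walk a b), a ≠ w → w ∉ q.support := by
    intro a b q
    induction q with
    | nil => intro h; simpa using h.symm
    | cons h q ih =>
      intro ha
      rw [SimpleGraph.Walk.support_cons, List.mem_cons, not_or]
      refine ⟨ha.symm, ih ?_⟩
      rintro rfl
      rw [SimpleGraph.between_adj] at h
      rcases h.2 with h | h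
      · exact hwX h.2
      · exact hwW h.2
  have hxw : x ≠ w := fun h => hwX (h ▸ hx)
  have hxu : x ≠ u := fun h => hu (h ▸ hx)
  have hle : G.between W X ≤ G := SimpleGraph.between_le
  have hw : w ∉ (p.mapLe hle).support := by
    rw [SimpleGraph.Walk.support_mapLe_eq_support]
    exact hsupp _ _ p hxw
  have hcyc : (SimpleGraph.Walk.cons hwu.symm
      (SimpleGraph.Walk.cons hwx (p.mapLe hle))).IsCycle := by
    rw [SimpleGraph.Walk.cons_isCycle_iff, SimpleGraph.Walk.cons_isPath_iff]
    refine ⟨⟨hp.mapLe hle, hw⟩, ?_⟩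
    rw [SimpleGraph.Walk.edges_cons, List.mem_cons, not_or]
    constructor
    · rw [Sym2.eq_iff]
      rintro (⟨h1, -⟩ | ⟨h1, -⟩)
      · exact hwu.ne h1.symm
      · exact hxu h1.symm
    · intro h
      exact hw (SimpleGraph.Walk.snd_mem_support_of_mem_edges _ h)
  have hmem : ∀ a ∈ (SimpleGraph.Walk.cons hwu.symm
      (SimpleGraph.Walk.cons hwx (p.mapLe hle))).support, a ∈ C.verts := by
    intro a ha
    rw [← hC.toSubgraph_eq hcyc, SimpleGraph.Walk.verts_toSubgraph]
    exact ha
  refine ⟨hmem x ?_, hmem w ?_, hmem u ?_⟩ <;> simp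

end Cycles

/-! ### Matchings and König–Egerváry graphs -/

section Matchings

open scoped Classical

variable {V : Type*} {G : SimpleGraph V}

lemma ncard_verts_of_isMatching [Finite V] {M : G.Subgraph} (hM : M.IsMatching) :
    M.verts.ncard = 2 * M.edgeSet.ncard := by
  cases nonempty_fintype V
  have h1 := M.spanningCoe.sum_degrees_eq_twice_card_edges
  have h2 : ∀ v, M.spanningCoe.degree v = if v ∈ M.verts then 1 else 0 := by
    intro v
    rw [SimpleGraph.Subgraph.degree_spanningCoe]
    split_ifs with h
    · exact SimpleGraph.Subgraph.isMatching_iff_forall_degree.1 hM v h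
    · exact SimpleGraph.Subgraph.degree_of_notMem_verts h
  simp only [h2, Finset.sum_boole, Nat.cast_id] at h1
  have h3 : M.edgeSet.ncard = M.spanningCoe.edgeFinset.card := by
    rw [← SimpleGraph.Subgraph.edgeSet_spanningCoe, ← SimpleGraph.coe_edgeFinset,
      Set.ncard_coe_finset]
  rw [h3, ← h1, ← Set.ncard_coe_finset]
  congr 1
  ext v
  simp

/-- Partners of saturated vertices of `S` lie outside `S`, so at most half of the saturated vertices
are in `S`; in the case of equality, partnership is a bijection onto the complement of `S`. -/
lemma ncard_edgeSet_le_card_compl [Fintype V] {M : G.Subgraph} (hM : M.IsMatching) {S : Finset V}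
    (hS : G.IsIndepSet (S : Set V)) :
    M.edgeSet.ncard ≤ Sᶜ.card ∧
      (Sᶜ.card ≤ M.edgeSet.ncard → ∀ v ∉ S, ∃ w ∈ S, M.Adj v w) := by
  rw [isIndepSet_iff_forall_not_adj] at hS
  have hex : ∀ v : V, ∃ w, v ∈ M.verts → M.Adj v w := by
    intro v
    by_cases h : v ∈ M.verts
    · obtain ⟨w, hw, -⟩ := hM h
      exact ⟨w, fun _ => hw⟩
    · exact ⟨v, fun h' => absurd h' h⟩
  choose g hg using hex
  set A := S.filter (· ∈ M.verts) with hA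
  set B := Sᶜ.filter (· ∈ M.verts) with hB
  have hAmem : ∀ v, v ∈ A ↔ v ∈ S ∧ v ∈ M.verts := fun v => Finset.mem_filter
  have hBmem : ∀ v, v ∈ B ↔ v ∉ S ∧ v ∈ M.verts := fun v => by
    rw [hB, Finset.mem_filter, Finset.mem_compl]
  have hcard : A.card + B.card = 2 * M.edgeSet.ncard := by
    rw [← ncard_verts_of_isMatching hM, ← Finset.card_union_of_disjoint, ← Set.ncard_coe_finset]
    · congr 1
      ext v
      simp only [Finset.coe_union, Set.mem_union, Finset.mem_coe, hAmem, hBmem]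
      tauto
    · rw [Finset.disjoint_left]
      intro v hv hv'
      exact ((hBmem v).1 hv').1 ((hAmem v).1 hv).1
  have hginj : Set.InjOn g A := by
    intro a ha b hb hab
    have h1 := hg a ((hAmem a).1 ha).2
    have h2 := hg b ((hAmem b).1 hb).2
    rw [← hab] at h2
    exact hM.eq_of_adj_right h1 h2
  have hgimg : A.image g ⊆ B := by
    intro w hw
    obtain ⟨v, hv, rfl⟩ := Finset.mem_image.1 hw
    obtain ⟨hvS, hvM⟩ := (hAmem v).1 hv
    have := hg v hvM
    exact (hBmem _).2 ⟨fun h => hS v hvS _ h this.adj_sub, this.snd_mem⟩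
  have hAB : A.card ≤ B.card := by
    rw [← Finset.card_image_of_injOn hginj]
    exact Finset.card_le_card hgimg
  have hBle : B.card ≤ Sᶜ.card := Finset.card_filter_le _ _
  refine ⟨by omega, fun hle v hv => ?_⟩
  have hB' : B = Sᶜ := Finset.eq_of_subset_of_card_le (Finset.filter_subset _ _) (by omega)
  have himg : A.image g = B := Finset.eq_of_subset_of_card_le hgimg (by
    rw [Finset.card_image_of_injOn hginj]
    omega)
  have hvB : v ∈ A.image g := by
    rw [himg, hB', Finset.mem_compl]
    exact hv
  obtain ⟨w, hw, rfl⟩ := Finset.mem_image.1 hvB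
  exact ⟨w, ((hAmem w).1 hw).1, (hg w ((hAmem w).1 hw).2).symm⟩

/-- The subgraph of `G` with edges `{v, f v}` for `v ∈ D`. -/
def subgraphOfFun (D : Finset V) (f : V → V) (hf : ∀ v ∈ D, G.Adj v (f v)) : G.Subgraph where
  verts := D ∪ f '' D
  Adj a b := (a ∈ D ∧ b = f a) ∨ (b ∈ D ∧ a = f b)
  adj_sub := by
    rintro a b (⟨h, rfl⟩ | ⟨h, rfl⟩)
    · exact hf a h
    · exact (hf b h).symm
  edge_vert := by
    rintro a b (⟨h, rfl⟩ | ⟨h, rfl⟩)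
    · exact Or.inl h
    · exact Or.inr ⟨b, h, rfl⟩
  symm := ⟨fun a b h => h.symm⟩

lemma isMatching_subgraphOfFun {D : Finset V} {f : V → V} (hf : ∀ v ∈ D, G.Adj v (f v))
    (hinj : Set.InjOn f D) (hD : ∀ v ∈ D, f v ∉ D) : (subgraphOfFun D f hf).IsMatching := by
  intro v hv
  rcases hv with hv | ⟨u, hu, rfl⟩
  · have hv' : v ∈ D := hv
    refine ⟨f v, Or.inl ⟨hv, rfl⟩, ?_⟩
    rintro w (⟨-, rfl⟩ | ⟨hw, rfl⟩)
    · rfl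
    · exact absurd hv' (hD w hw)
  · refine ⟨u, Or.inr ⟨hu, rfl⟩, ?_⟩
    rintro w (⟨h, -⟩ | ⟨hw, hw'⟩)
    · exact absurd h (hD u hu)
    · exact (hinj hu hw hw').symm

lemma ncard_edgeSet_subgraphOfFun [Finite V] {D : Finset V} {f : V → V}
    (hf : ∀ v ∈ D, G.Adj v (f v)) (hinj : Set.InjOn f D) (hD : ∀ v ∈ D, f v ∉ D) :
    (subgraphOfFun D f hf).edgeSet.ncard = D.card := by
  have h1 := ncard_verts_of_isMatching (isMatching_subgraphOfFun hf hinj hD)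
  have h2 : (subgraphOfFun D f hf).verts = ((D ∪ D.image f : Finset V) : Set V) := by
    simp [subgraphOfFun]
  have hd : Disjoint D (D.image f) := by
    rw [Finset.disjoint_left]
    intro a ha ha'
    obtain ⟨b, hb, rfl⟩ := Finset.mem_image.1 ha'
    exact hD b hb ha
  rw [h2, Set.ncard_coe_finset, Finset.card_union_of_disjoint hd,
    Finset.card_image_of_injOn hinj] at h1
  omega

lemma isMatching_subgraphOfFun_compl [Fintype V] {S : Finset V} {f : V → V}
    (hf : ∀ v ∈ Sᶜ, f v ∈ S ∧ G.Adj v (f v)) (hinj : Set.InjOn f (Sᶜ : Finset V)) :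
    (subgraphOfFun Sᶜ f fun v hv => (hf v hv).2).IsMatching ∧
      (subgraphOfFun Sᶜ f fun v hv => (hf v hv).2).edgeSet.ncard = Sᶜ.card := by
  have hD : ∀ v ∈ Sᶜ, f v ∉ Sᶜ := fun v hv h => Finset.mem_compl.1 h (hf v hv).1
  exact ⟨isMatching_subgraphOfFun _ hinj hD, ncard_edgeSet_subgraphOfFun _ hinj hD⟩

lemma isMaximumMatching_subgraphOfFun_compl [Fintype V] {S : Finset V} {f : V → V}
    (hS : G.IsIndepSet (S : Set V))
    (hf : ∀ v ∈ Sᶜ, f v ∈ S ∧ G.Adj v (f v)) (hinj : Set.InjOn f (Sᶜ : Finset V)) :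
    IsMaximumMatching (subgraphOfFun Sᶜ f fun v hv => (hf v hv).2) := by
  obtain ⟨h1, h2⟩ := isMatching_subgraphOfFun_compl hf hinj
  refine ⟨h1, fun M' hM' => ?_⟩
  rw [h2]
  exact (ncard_edgeSet_le_card_compl hM' hS).1

lemma matchingNum_bddAbove [Finite V] (G : SimpleGraph V) :
    BddAbove {n | ∃ M : G.Subgraph, M.IsMatching ∧ M.edgeSet.ncard = n} := by
  refine ⟨Nat.card (Sym2 V), ?_⟩
  rintro n ⟨M, -, rfl⟩
  rw [← Set.ncard_univ]
  exact Set.ncard_le_ncard (Set.subset_univ _) (Set.toFinite _)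

lemma exists_isMatching_ncard_eq_matchingNum [Finite V] (G : SimpleGraph V) :
    ∃ M : G.Subgraph, M.IsMatching ∧ M.edgeSet.ncard = matchingNum G := by
  have hbot : (⊥ : G.Subgraph).IsMatching := fun v hv => by simp at hv
  exact Nat.sSup_mem (s := {n | ∃ M : G.Subgraph, M.IsMatching ∧ M.edgeSet.ncard = n})
    ⟨_, ⊥, hbot, rfl⟩ (matchingNum_bddAbove G)

/-- A graph is König–Egerváry if and only if the complement of a maximum stable set `S` can be
matched into `S`. -/
lemma isKonigEgervary_iff [Fintype V] {S : Finset V} (hS : G.IsMaximumIndepSet S) :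
    IsKonigEgervary G ↔ ∃ f : V → V, Set.InjOn f {v | v ∉ S} ∧
      ∀ v ∉ S, f v ∈ S ∧ G.Adj v (f v) := by
  have hα := SimpleGraph.maximumIndepSet_card_eq_indepNum S hS
  have hc := Finset.card_add_card_compl S
  unfold IsKonigEgervary
  rw [← hα, Nat.card_eq_fintype_card]
  obtain ⟨M, hM, hMn⟩ := exists_isMatching_ncard_eq_matchingNum G
  obtain ⟨h1, h2⟩ := ncard_edgeSet_le_card_compl hM hS.isIndepSet
  rw [hMn] at h1 h2
  constructor
  · intro h
    have h3 : ∀ v : V, ∃ w, v ∉ S → w ∈ S ∧ M.Adj v w := by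
      intro v
      by_cases hv : v ∈ S
      · exact ⟨v, fun h => absurd hv h⟩
      · obtain ⟨w, hw⟩ := h2 (by omega) v hv
        exact ⟨w, fun _ => hw⟩
    choose f hf using h3
    refine ⟨f, fun a ha b hb hab => ?_, fun v hv => ⟨(hf v hv).1, (hf v hv).2.adj_sub⟩⟩
    have ha' := (hf a ha).2
    have hb' := (hf b hb).2
    rw [← hab] at hb'
    exact hM.eq_of_adj_right ha' hb'
  · rintro ⟨f, hinj, hf⟩
    obtain ⟨h3, h4⟩ := isMatching_subgraphOfFun_compl (S := S) (f := f)
      (fun v hv => hf v (Finset.mem_compl.1 hv)) (hinj.mono fun v hv => Finset.mem_compl.1 hv)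
    have h5 : Sᶜ.card ≤ matchingNum G := le_csSup (matchingNum_bddAbove G) ⟨_, h3, h4⟩
    omega

/-- A matching is uniquely restricted if and only if no other matching of `G` saturates the same
vertices. -/
lemma isUniquelyRestricted_iff {M : G.Subgraph} (hM : M.IsMatching) :
    IsUniquelyRestricted M ↔
      ∀ M' : G.Subgraph, M'.IsMatching → M'.verts = M.verts → M' = M := by
  have hperf : ∀ M' : G.Subgraph, M'.IsMatching → M'.verts = M.verts →
      (M'.comap (SimpleGraph.Embedding.induce (G := G) M.verts).toHom).IsPerfectMatching := by
    intro M' hM' hv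
    rw [SimpleGraph.Subgraph.isPerfectMatching_iff]
    rintro ⟨v, hvM⟩
    obtain ⟨w, hw, hw'⟩ := hM' (hv ▸ hvM)
    refine ⟨⟨w, hv ▸ hw.snd_mem⟩, ⟨hw.adj_sub, hw⟩, ?_⟩
    rintro ⟨u, hu⟩ h
    exact Subtype.ext (hw' u h.2)
  constructor
  · rintro ⟨-, -, h⟩ M' hM' hv
    have heq := h _ (hperf M' hM' hv)
    refine SimpleGraph.Subgraph.ext hv ?_
    ext a b
    constructor
    · intro hab
      have ha : a ∈ M.verts := hv ▸ hab.fst_mem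
      have hb : b ∈ M.verts := hv ▸ hab.snd_mem
      have h1 : (M'.comap (SimpleGraph.Embedding.induce (G := G) M.verts).toHom).Adj
        ⟨a, ha⟩ ⟨b, hb⟩ := ⟨hab.adj_sub, hab⟩
      rw [heq] at h1
      exact h1.2
    · intro hab
      have h1 : (M.comap (SimpleGraph.Embedding.induce (G := G) M.verts).toHom).Adj
        ⟨a, hab.fst_mem⟩ ⟨b, hab.snd_mem⟩ := ⟨hab.adj_sub, hab⟩
      rw [← heq] at h1
      exact h1.2
  · intro h
    refine ⟨hM, hperf M hM rfl, fun P hP => ?_⟩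
    have h1 : (P.map (SimpleGraph.Embedding.induce (G := G) M.verts).toHom) = M := by
      refine h _ (hP.1.map _ (SimpleGraph.Embedding.induce (G := G) M.verts).injective) ?_
      ext v
      simp only [SimpleGraph.Subgraph.map_verts, hP.2.verts_eq_univ]
      simp
    have h2 : ∀ x y, (P.map (SimpleGraph.Embedding.induce (G := G) M.verts).toHom).Adj x y ↔
        M.Adj x y := fun x y => iff_of_eq (congrArg (fun N : G.Subgraph => N.Adj x y) h1)
    have hvert : P.verts = Set.univ := hP.2.verts_eq_univ
    refine SimpleGraph.Subgraph.ext ?_ ?_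
    · rw [hvert]
      ext v
      simp only [Set.mem_univ, true_iff]
      exact v.2
    · ext a b
      constructor
      · intro hab
        refine ⟨hab.adj_sub, ?_⟩
        refine (h2 _ _).1 ?_
        exact ⟨a, b, hab, rfl, rfl⟩
      · rintro ⟨-, hab⟩
        obtain ⟨a', b', hab', ha, hb⟩ := (h2 _ _).2 hab
        have ha' : a' = a := Subtype.ext ha
        have hb' : b' = b := Subtype.ext hb
        rwa [← ha', ← hb']

end Matchings

/-! ### Accessibility in unicyclic graphs -/

section Accessibility

open scoped Classical

variable {V : Type*} {G : SimpleGraph V}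

lemma adj_of_isMaximumIndepSet [Finite V] {S : Finset V} (hS : G.IsMaximumIndepSet S) {v : V}
    (hv : v ∉ S) : ∃ s ∈ S, G.Adj v s := by
  by_contra! h
  have hSi := isIndepSet_iff_forall_not_adj.1 hS.isIndepSet
  have := hS.maximum (insert v S) (by
    rw [isIndepSet_iff_forall_not_adj]
    intro a ha b hb hab
    simp only [Finset.coe_insert, Set.mem_insert_iff, Finset.mem_coe] at ha hb
    rcases ha with rfl | ha <;> rcases hb with rfl | hb
    · exact hab.ne rfl
    · exact h b hb hab
    · exact h a ha hab.symm
    · exact hSi a ha b hb hab)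
  rw [Finset.card_insert_of_notMem hv] at this
  omega

lemma isLocalMaxStable_of_isMaximumIndepSet [Finite V] {S : Finset V}
    (hS : G.IsMaximumIndepSet S) : IsLocalMaxStable G S :=
  isLocalMaxStable_iff.2 ⟨hS.isIndepSet, fun T hT _ => hS.maximum T hT⟩

/-- König's theorem, obtained from Hall's condition for `N(S) = Sᶜ`. -/
lemma exists_injOn_compl_of_coloring [Fintype V] (c : G.Coloring Bool) {S : Finset V}
    (hS : G.IsMaximumIndepSet S) :
    ∃ f : V → V, Set.InjOn f (Sᶜ : Finset V) ∧ ∀ v ∈ Sᶜ, f v ∈ S ∧ G.Adj v (f v) := by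
  refine exists_injOn_of_hall fun W hW => ?_
  refine hallNbhd_of_coloring c (isLocalMaxStable_of_isMaximumIndepSet hS) W fun w hw => ?_
  have hwS : w ∉ S := Finset.mem_compl.1 (hW hw)
  exact mem_nbhd.2 ⟨hwS, adj_of_isMaximumIndepSet hS hwS⟩

/-- A local maximum stable set extends to a maximum stable set (Nemhauser–Trotter). -/
lemma exists_isMaximumIndepSet_superset [Finite V] {X : Finset V} (hX : IsLocalMaxStable G X) :
    ∃ S, X ⊆ S ∧ G.IsMaximumIndepSet S := by
  obtain ⟨T, hT⟩ := SimpleGraph.maximumIndepSet_exists (G := G)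
  obtain ⟨hXi, hXm⟩ := isLocalMaxStable_iff.1 hX
  have hXi' := isIndepSet_iff_forall_not_adj.1 hXi
  have hTi := isIndepSet_iff_forall_not_adj.1 hT.isIndepSet
  set T1 := T.filter (· ∈ closedNbhd G (X : Set V)) with hT1
  set T2 := T.filter (· ∉ closedNbhd G (X : Set V)) with hT2
  have hsum : T1.card + T2.card = T.card := Finset.card_filter_add_card_filter_not _
  have h1 : T1.card ≤ X.card := hXm T1
    (isIndepSet_mono hT.isIndepSet (fun t ht => (Finset.mem_filter.1 ht).1))
    (fun t ht => (Finset.mem_filter.1 ht).2)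
  have hT2m : ∀ t ∈ T2, t ∈ T ∧ t ∉ X ∧ ∀ x ∈ X, ¬ G.Adj t x := by
    intro t ht
    have := Finset.mem_filter.1 ht
    rw [mem_closedNbhd] at this
    push Not at this
    exact this
  have hd : Disjoint X T2 := by
    rw [Finset.disjoint_left]
    intro x hx hx'
    exact (hT2m x hx').2.1 hx
  refine ⟨X ∪ T2, Finset.subset_union_left, ?_, fun S hS => ?_⟩
  · rw [isIndepSet_iff_forall_not_adj]
    intro a ha b hb hab
    simp only [Finset.coe_union, Set.mem_union, Finset.mem_coe] at ha hb
    rcases ha with ha | ha <;> rcases hb with hb | hb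
    · exact hXi' a ha b hb hab
    · exact (hT2m b hb).2.2 a ha hab.symm
    · exact (hT2m a ha).2.2 b hb hab
    · exact hTi a (hT2m a ha).1 b (hT2m b hb).1 hab
  · rw [Finset.card_union_of_disjoint hd]
    have := hT.maximum S hS
    omega

/-- The two matchings of `N(X)` supplied by an inaccessible `X` extend, by a matching of the rest of
the complement of a maximum stable set containing `X`, to two maximum matchings of `G` saturating
the same vertices. -/
lemma accessible_of_isUniquelyRestricted [Finite V] (c : G.Coloring Bool)
    (hur : ∀ M : G.Subgraph, IsMaximumMatching M → IsUniquelyRestricted M)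
    (X : Finset V) (hX : IsLocalMaxStable G X) (hne : X.Nonempty) :
    ∃ x ∈ X, IsLocalMaxStable G (X.erase x) := by
  by_contra! hbad
  cases nonempty_fintype V
  set D : Finset V := Finset.univ.filter (· ∈ nbhd G (X : Set V)) with hDdef
  have hD : (D : Set V) = nbhd G (X : Set V) := by
    ext v
    simp [hDdef]
  have hDmem : ∀ v, v ∈ D ↔ v ∉ X ∧ ∃ x ∈ X, G.Adj v x := by
    intro v
    rw [← Finset.mem_coe, hD, mem_nbhd]
    simp
  obtain ⟨f, f', hf, hf', hfX, hfX', himg, w, hw, hww⟩ :=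
    exists_two_matchings_of_inaccessible hX hne hbad (hallNbhd_of_coloring c hX) hD
  obtain ⟨S, hXS, hS⟩ := exists_isMaximumIndepSet_superset hX
  obtain ⟨g, hg, hgS⟩ := exists_injOn_compl_of_coloring c hS
  have hSi := isIndepSet_iff_forall_not_adj.1 hS.isIndepSet
  have hDS : D ⊆ Sᶜ := by
    intro v hv
    obtain ⟨-, x, hx, hvx⟩ := (hDmem v).1 hv
    exact Finset.mem_compl.2 fun hvS => hSi v hvS x (hXS hx) hvx
  have hgX : ∀ v ∈ Sᶜ, v ∉ D → g v ∉ X := by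
    intro v hv hvD hgv
    exact hvD ((hDmem v).2 ⟨fun h => Finset.mem_compl.1 hv (hXS h), g v, hgv, (hgS v hv).2⟩)
  have hpw : ∀ e : V → V, Set.InjOn e D → (∀ w ∈ D, e w ∈ X ∧ G.Adj w (e w)) →
      Set.InjOn (D.piecewise e g) (Sᶜ : Finset V) ∧
        ∀ v ∈ Sᶜ, D.piecewise e g v ∈ S ∧ G.Adj v (D.piecewise e g v) := by
    intro e he heX
    constructor
    · intro a ha b hb hab
      by_cases haD : a ∈ D <;> by_cases hbD : b ∈ D <;>
        simp only [haD, hbD, Finset.piecewise_eq_of_mem, Finset.piecewise_eq_of_notMem,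
          not_false_eq_true] at hab
      · exact he haD hbD hab
      · exact absurd (hab ▸ (heX a haD).1) (hgX b hb hbD)
      · exact absurd (hab ▸ (heX b hbD).1) (hgX a ha haD)
      · exact hg ha hb hab
    · intro v hv
      by_cases hvD : v ∈ D
      · simp only [hvD, Finset.piecewise_eq_of_mem]
        exact ⟨hXS (heX v hvD).1, (heX v hvD).2⟩
      · simp only [hvD, not_false_eq_true, Finset.piecewise_eq_of_notMem]
        exact hgS v hv
  obtain ⟨hF1, hF2⟩ := hpw f hf hfX
  obtain ⟨hF1', hF2'⟩ := hpw f' hf' hfX'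
  have hmax := isMaximumMatching_subgraphOfFun_compl hS.isIndepSet hF2 hF1
  have hmax' := isMaximumMatching_subgraphOfFun_compl hS.isIndepSet hF2' hF1'
  have hsub : ∀ e e' : V → V, D.image e = D.image e' →
      D.piecewise e g '' (Sᶜ : Finset V) ⊆ D.piecewise e' g '' (Sᶜ : Finset V) := by
    rintro e e' hee _ ⟨v, hv, rfl⟩
    by_cases hvD : v ∈ D
    · have : e v ∈ D.image e' := hee ▸ Finset.mem_image_of_mem e hvD
      obtain ⟨u, hu, huv⟩ := Finset.mem_image.1 this
      exact ⟨u, hDS hu, by simp [hu, hvD, huv]⟩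
    · exact ⟨v, hv, by simp [hvD]⟩
  have hverts : (subgraphOfFun Sᶜ (D.piecewise f' g) fun v hv => (hF2' v hv).2).verts =
      (subgraphOfFun Sᶜ (D.piecewise f g) fun v hv => (hF2 v hv).2).verts := by
    change (_ ∪ _ : Set V) = _ ∪ _
    rw [Set.Subset.antisymm (hsub f' f himg) (hsub f f' himg.symm)]
  have heq := (isUniquelyRestricted_iff hmax.1).1 (hur _ hmax) _ hmax'.1 hverts
  have h1 : (subgraphOfFun Sᶜ (D.piecewise f g) fun v hv => (hF2 v hv).2).Adj w (f w) :=
    Or.inl ⟨hDS hw, by simp [hw]⟩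
  have h2 : (subgraphOfFun Sᶜ (D.piecewise f g) fun v hv => (hF2 v hv).2).Adj w (f' w) := by
    rw [← heq]
    exact Or.inl ⟨hDS hw, by simp [hw]⟩
  exact hww (hmax.1.eq_of_adj_left h1 h2)

/-- If `g` matches `D` onto a set containing `X`, the vertices matched into `X` are exactly the
neighbors of `X` in `D`, because Hall's condition leaves no room for more. -/
lemma apply_mem_iff_exists_adj [Finite V] {D X : Finset V} {g : V → V}
    (hX : IsLocalMaxStable G X) (hhall : HallNbhd G X) (hg : ∀ v ∈ D, G.Adj v (g v))
    (hXg : X ⊆ D.image g) : ∀ v ∈ D, g v ∈ X ↔ ∃ x ∈ X, G.Adj v x := by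
  intro v hv
  have hXi := isIndepSet_iff_forall_not_adj.1 (isLocalMaxStable_iff.1 hX).1
  set N := D.filter fun v => ∃ x ∈ X, G.Adj v x with hN
  set P := D.filter fun v => g v ∈ X with hP
  have hPN : P ⊆ N := by
    intro u hu
    obtain ⟨huD, hu⟩ := Finset.mem_filter.1 hu
    exact Finset.mem_filter.2 ⟨huD, g u, hu, hg u huD⟩
  have hNX : N.card ≤ X.card := by
    refine (hhall N ?_).trans (Finset.card_le_card (Finset.filter_subset _ _))
    intro u hu
    obtain ⟨x, hx, hux⟩ := (Finset.mem_filter.1 hu).2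
    exact mem_nbhd.2 ⟨fun h => hXi u h x hx hux, x, hx, hux⟩
  have hXP : X.card ≤ P.card := by
    refine (Finset.card_le_card ?_).trans (Finset.card_image_le (f := g))
    intro x hx
    obtain ⟨u, hu, rfl⟩ := Finset.mem_image.1 (hXg hx)
    exact Finset.mem_image_of_mem g (Finset.mem_filter.2 ⟨hu, hx⟩)
  have hmem : v ∈ P ↔ v ∈ N := by rw [Finset.eq_of_subset_of_card_le hPN (hNX.trans hXP)]
  simpa [hP, hN, hv] using hmem

/-- Two matchings of `D` whose ranges contain `X` agree on the vertices matched into `X`: the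
preimages of every set in the construction of `X` are determined by its neighborhood, so each step
determines one more edge. -/
lemma matching_eq_of_accessible [Finite V]
    (hacc : ∀ X ∈ localMaxStableSets G, X.Nonempty → ∃ x ∈ X, X.erase x ∈ localMaxStableSets G)
    (hhall : ∀ X : Finset V, IsLocalMaxStable G X → HallNbhd G X)
    {D : Finset V} {f f' : V → V}
    (hf : ∀ v ∈ D, G.Adj v (f v)) (hf' : ∀ v ∈ D, G.Adj v (f' v))
    (X : Finset V) (hX : IsLocalMaxStable G X)
    (hXf : X ⊆ D.image f) (hXf' : X ⊆ D.image f') :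
    ∀ v ∈ D, f v ∈ X → f v = f' v := by
  induction hn : X.card using Nat.strong_induction_on generalizing X with
  | _ n ih =>
    intro v hv hvX
    obtain ⟨x, hx, hxF⟩ := hacc X hX ⟨_, hvX⟩
    have hsub := X.erase_subset x
    have hiff : ∀ Z, Z ⊆ X → IsLocalMaxStable G Z → (f v ∈ Z ↔ f' v ∈ Z) := fun Z hZX hZ =>
      (apply_mem_iff_exists_adj hZ (hhall Z hZ) hf (hZX.trans hXf) v hv).trans
        (apply_mem_iff_exists_adj hZ (hhall Z hZ) hf' (hZX.trans hXf') v hv).symm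
    by_cases hve : f v ∈ X.erase x
    · exact ih (X.erase x).card (by rw [← hn]; exact Finset.card_erase_lt_of_mem hx) _ hxF
        (hsub.trans hXf) (hsub.trans hXf') rfl v hv hve
    · have h1 : f' v ∈ X := (hiff X subset_rfl hX).1 hvX
      have h2 : f' v ∉ X.erase x := fun h => hve ((hiff _ hsub hxF).2 h)
      rw [Finset.mem_erase] at hve h2
      rw [show f v = x by tauto, show f' v = x by tauto]

/-- With `S` a maximum stable set, every maximum matching `M` matches the complement of `S` into `S`,
onto the set `X` of saturated vertices of `S`. This `X` is a local maximum stable set, so its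
construction determines `M`. -/
lemma isUniquelyRestricted_of_accessible [Finite V] (c : G.Coloring Bool)
    (hacc : ∀ X ∈ localMaxStableSets G, X.Nonempty → ∃ x ∈ X, X.erase x ∈ localMaxStableSets G)
    {M : G.Subgraph} (hM : IsMaximumMatching M) : IsUniquelyRestricted M := by
  cases nonempty_fintype V
  rw [isUniquelyRestricted_iff hM.1]
  intro M' hM' hverts
  obtain ⟨S, hS⟩ := SimpleGraph.maximumIndepSet_exists (G := G)
  have hSi := isIndepSet_iff_forall_not_adj.1 hS.isIndepSet
  obtain ⟨g, hg, hgS⟩ := exists_injOn_compl_of_coloring c hS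
  obtain ⟨hm, hmcard⟩ := isMatching_subgraphOfFun_compl hgS hg
  have hcard : Sᶜ.card ≤ M.edgeSet.ncard := hmcard ▸ hM.2 _ hm
  have hcard' : Sᶜ.card ≤ M'.edgeSet.ncard := by
    have h1 := ncard_verts_of_isMatching hM.1
    have h2 := ncard_verts_of_isMatching hM'
    rw [hverts] at h2
    omega
  have hpartner : ∀ N : G.Subgraph, N.IsMatching → Sᶜ.card ≤ N.edgeSet.ncard →
      N.verts = M.verts → ∃ p : V → V, (∀ v ∈ Sᶜ, N.Adj v (p v)) ∧
        Set.InjOn p (Sᶜ : Finset V) ∧ Sᶜ.image p = S.filter (· ∈ M.verts) := by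
    intro N hN hNc hNv
    have hex : ∀ v : V, ∃ w, v ∈ Sᶜ → w ∈ S ∧ N.Adj v w := by
      intro v
      by_cases hv : v ∈ Sᶜ
      · obtain ⟨w, hw⟩ := (ncard_edgeSet_le_card_compl hN hS.isIndepSet).2 hNc v
          (Finset.mem_compl.1 hv)
        exact ⟨w, fun _ => hw⟩
      · exact ⟨v, fun h => absurd h hv⟩
    choose p hp using hex
    refine ⟨p, fun v hv => (hp v hv).2, ?_, ?_⟩
    · intro a ha b hb hab
      have ha' := (hp a ha).2
      have hb' := (hp b hb).2
      rw [← hab] at hb'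
      exact hN.eq_of_adj_right ha' hb'
    · ext s
      rw [Finset.mem_image, Finset.mem_filter]
      constructor
      · rintro ⟨v, hv, rfl⟩
        exact ⟨(hp v hv).1, hNv ▸ (hp v hv).2.snd_mem⟩
      · rintro ⟨hs, hsM⟩
        rw [← hNv] at hsM
        obtain ⟨v, hsv, -⟩ := hN hsM
        have hv : v ∈ Sᶜ := Finset.mem_compl.2 fun h => hSi s hs v h hsv.adj_sub
        exact ⟨v, hv, hN.eq_of_adj_left (hp v hv).2 hsv.symm⟩
  obtain ⟨p, hp, hpinj, himg⟩ := hpartner M hM.1 hcard rfl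
  obtain ⟨p', hp', -, himg'⟩ := hpartner M' hM' hcard' hverts
  set X := S.filter (· ∈ M.verts) with hXdef
  have hXS : X ⊆ S := Finset.filter_subset _ _
  have hX : IsLocalMaxStable G X := by
    rw [isLocalMaxStable_iff_hall]
    refine ⟨isIndepSet_mono hS.isIndepSet (by exact_mod_cast hXS), fun W _ hW => ?_⟩
    refine card_le_card_nbrIn_of_injOn (D := Sᶜ) hpinj (fun v hv => ⟨?_, (hp v hv).adj_sub⟩) ?_
    · rw [← himg]
      exact Finset.mem_image_of_mem p hv
    · intro w hw
      obtain ⟨-, x, hx, hwx⟩ := mem_nbhd.1 (hW hw)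
      exact Finset.mem_compl.2 fun h => hSi w h x (hXS hx) hwx
  have heq : ∀ v ∈ Sᶜ, p v = p' v := fun v hv =>
    matching_eq_of_accessible hacc (fun Z hZ => hallNbhd_of_coloring c hZ)
      (fun u hu => (hp u hu).adj_sub) (fun u hu => (hp' u hu).adj_sub) X hX
      himg.superset himg'.superset v hv
      (by rw [← himg]; exact Finset.mem_image_of_mem p hv)
  -- both matchings consist of the edges `{v, p v}` with `v` outside `S`
  have hadj : ∀ v ∈ Sᶜ, ∀ w, M'.Adj v w ↔ M.Adj v w := by
    intro v hv w
    have h1 := hp v hv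
    have h2 := hp' v hv
    rw [← heq v hv] at h2
    constructor
    · intro h
      rw [hM'.eq_of_adj_left h h2]
      exact h1
    · intro h
      rw [hM.1.eq_of_adj_left h h1]
      exact h2
  refine SimpleGraph.Subgraph.ext hverts ?_
  ext a b
  by_cases ha : a ∈ S
  · by_cases hb : b ∈ S
    · exact ⟨fun h => absurd h.adj_sub (hSi a ha b hb), fun h => absurd h.adj_sub (hSi a ha b hb)⟩
    · rw [M'.adj_comm, M.adj_comm]
      exact hadj b (Finset.mem_compl.2 hb) a
  · exact hadj a (Finset.mem_compl.2 ha) b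

/-- `X` is a maximum stable set of `G[N[X]]` with complement `N(X)`. -/
lemma isKonigEgervary_induce_iff [Finite V] {X : Finset V} (hX : IsLocalMaxStable G X) :
    IsKonigEgervary (G.induce (closedNbhd G (X : Set V))) ↔ HallNbhd G X := by
  cases nonempty_fintype V
  have hX' : (G.induce (closedNbhd G (X : Set V))).IsMaximumIndepSet
    (X.subtype (· ∈ closedNbhd G (X : Set V))) := hX
  set D : Finset V := Finset.univ.filter (· ∈ nbhd G (X : Set V)) with hDdef
  have hDmem : ∀ v, v ∈ D ↔ v ∈ nbhd G (X : Set V) := by simp [hDdef]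
  rw [isKonigEgervary_iff hX']
  constructor
  · rintro ⟨f, hf, hfX⟩
    let F : V → V := fun v => if h : v ∈ closedNbhd G (X : Set V) then f ⟨v, h⟩ else v
    have hF : ∀ v, (h : v ∈ closedNbhd G (X : Set V)) → F v = f ⟨v, h⟩ :=
      fun v h => dif_pos h
    have hDc : ∀ v ∈ D, ∃ h : v ∈ closedNbhd G (X : Set V),
        (⟨v, h⟩ : closedNbhd G (X : Set V)) ∉ X.subtype (· ∈ closedNbhd G (X : Set V)) := by
      intro v hv
      have hv' := (hDmem v).1 hv
      refine ⟨Or.inr hv', ?_⟩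
      rw [Finset.mem_subtype]
      exact hv'.1
    intro W hW
    refine card_le_card_nbrIn_of_injOn (D := D) (f := F) ?_ ?_
      (fun w hw => (hDmem w).2 (hW hw))
    · intro a ha b hb hab
      obtain ⟨ha1, ha2⟩ := hDc a ha
      obtain ⟨hb1, hb2⟩ := hDc b hb
      rw [hF a ha1, hF b hb1] at hab
      have := hf ha2 hb2 (Subtype.ext hab)
      exact congrArg Subtype.val this
    · intro v hv
      obtain ⟨h1, h2⟩ := hDc v hv
      rw [hF v h1]
      obtain ⟨h3, h4⟩ := hfX _ h2
      exact ⟨Finset.mem_subtype.1 h3, h4⟩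
  · intro h
    obtain ⟨f, hf, hfX⟩ := exists_injOn_of_hall (G := G) (D := D) (X := X)
      (fun W hW => h W (fun w hw => (hDmem w).1 (hW hw)))
    have hXc : ∀ x ∈ X, x ∈ closedNbhd G (X : Set V) := fun x hx => Or.inl hx
    have hDc : ∀ v ∉ X.subtype (· ∈ closedNbhd G (X : Set V)), (v : V) ∈ D := by
      rintro ⟨v, hv⟩ hv'
      rw [Finset.mem_subtype] at hv'
      exact (hDmem v).2 (hv.resolve_left hv')
    refine ⟨fun v => if hv : (v : V) ∈ D then ⟨f v, hXc _ (hfX v hv).1⟩ else v, ?_, ?_⟩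
    · intro a ha b hb hab
      have ha' := hDc a ha
      have hb' := hDc b hb
      simp only [ha', hb', dif_pos, Subtype.mk.injEq] at hab
      exact Subtype.ext (hf ha' hb' hab)
    · intro v hv
      have hvD := hDc v hv
      simp only [hvD, dif_pos]
      exact ⟨Finset.mem_subtype.2 (hfX v hvD).1, (hfX v hvD).2⟩

/-- When the unique cycle is odd, a local maximum stable set satisfying Hall's condition on all of
`N(X)` is accessible: otherwise there would be an even cycle. -/
lemma IsUniqueCycle.accessible_of_hallNbhd [Finite V] {C : G.Subgraph} (hC : IsUniqueCycle C)
    (hodd : Odd C.verts.ncard) {X : Finset V} (hX : IsLocalMaxStable G X) (hhall : HallNbhd G X)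
    (hne : X.Nonempty) : ∃ x ∈ X, IsLocalMaxStable G (X.erase x) := by
  by_contra! hbad
  cases nonempty_fintype V
  set D : Finset V := Finset.univ.filter (· ∈ nbhd G (X : Set V)) with hDdef
  have hD : (D : Set V) = nbhd G (X : Set V) := by
    ext v
    simp [hDdef]
  obtain ⟨f, f', hf, hf', hfX, hfX', himg, hw⟩ :=
    exists_two_matchings_of_inaccessible hX hne hbad hhall hD
  have hdisj : Disjoint D X := by
    rw [Finset.disjoint_left]
    intro v hv hvX
    have : v ∈ nbhd G (X : Set V) := by
      rw [← hD]
      exact hv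
    exact this.1 hvX
  obtain ⟨v, c, hc, heven⟩ :=
    exists_even_cycle_of_two_matchings hdisj hf hf' hfX hfX' himg hw
  rw [hC.length_eq hc] at heven
  exact (Nat.not_even_iff_odd.2 hodd) heven

/-- When the unique cycle is a triangle, every inaccessible `X` would contain, for each `x ∈ X`,
another vertex `x' ≠ x` that is the only vertex of `X` on the triangle. The vertex `x'` is the
neighbor of a leaf `w` in the tight set of `x`; since `w` cannot be added to the tight set of
`x'`, it is adjacent to a member `u` of that set, and this closes a cycle through `x'`, `w`, `u`. -/
lemma IsUniqueCycle.exists_ne_mem_verts_of_inaccessible [Finite V] {C : G.Subgraph}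
    (hC : IsUniqueCycle C) (h3 : C.verts.ncard = 3) {X : Finset V} (hX : IsLocalMaxStable G X)
    (hbad : ∀ x ∈ X, ¬ IsLocalMaxStable G (X.erase x)) {x : V} (hx : x ∈ X) :
    ∃ x' ∈ X, x' ≠ x ∧ ∀ y ∈ X, y ∈ C.verts ↔ y = x' := by
  have hXh := (isLocalMaxStable_iff_hall.1 hX).2
  obtain ⟨W, hWi, hWX, hcard, hxW, hnbr, -⟩ := exists_tight_of_erase_not_mem hX hx (hbad x hx)
  have hleaf : ∃ w ∈ W, ∃ x' ∈ X, G.Adj w x' ∧ ∀ y ∈ X, y ≠ x' → ¬ G.Adj w y := by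
    by_contra! hdeg
    have hdeg' : ∀ w ∈ W, ∀ x ∈ X, G.Adj w x → ∃ y ∈ X, y ≠ x ∧ G.Adj w y := by
      intro w hw x hx hwx
      obtain ⟨y, hy⟩ := hdeg w hw x hx hwx
      exact ⟨y, hy⟩
    have hWne : W.Nonempty := by
      obtain ⟨-, w, hw, -⟩ := mem_nbrIn.1 hxW
      exact ⟨w, hw⟩
    obtain ⟨f, hf, hfX⟩ := exists_injOn_of_hall (G := G) (D := W) (X := X)
      (fun U hU => hXh U (isIndepSet_mono hWi (by exact_mod_cast hU)) (fun u hu => hWX (hU hu)))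
    obtain ⟨f', hf', hfX', himg, hw⟩ := exists_alternating hf subset_rfl hfX hcard hdeg' hWne
    have hdisj : Disjoint W X := by
      rw [Finset.disjoint_left]
      intro v hv hvX
      exact (hWX hv).1 hvX
    obtain ⟨v, c, hc, heven⟩ :=
      exists_even_cycle_of_two_matchings hdisj hf hf' hfX hfX' himg hw
    rw [hC.length_eq hc, h3] at heven
    exact absurd heven (by decide)
  obtain ⟨w, hw, x', hx', hwx', hleaf⟩ := hleaf
  have hxx : x' ≠ x := by
    rintro rfl
    obtain ⟨y, hy, hyx, hwy⟩ := hnbr w hw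
    exact hleaf y hy hyx hwy
  obtain ⟨W', hWi', hWX', hcard', hxW', hnbr', hreach⟩ :=
    exists_tight_of_erase_not_mem hX hx' (hbad x' hx')
  obtain ⟨hwW', hsub⟩ := nbrIn_insert_leaf hxW' hnbr' hleaf
  have hadj : ∃ u ∈ W', G.Adj w u := by
    by_contra! hno
    have hW' := isIndepSet_iff_forall_not_adj.1 hWi'
    have hle := hXh (insert w W') ?_ ?_
    · have := Finset.card_le_card hsub
      rw [Finset.card_insert_of_notMem hwW'] at hle
      omega
    · rw [isIndepSet_iff_forall_not_adj]
      intro a ha b hb hab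
      simp only [Finset.coe_insert, Set.mem_insert_iff, Finset.mem_coe] at ha hb
      rcases ha with rfl | ha <;> rcases hb with rfl | hb
      · exact hab.ne rfl
      · exact hno b hb hab
      · exact hno a ha hab.symm
      · exact hW' a ha b hb hab
    · intro u hu
      simp only [Finset.coe_insert, Set.mem_insert_iff, Finset.mem_coe] at hu
      rcases hu with rfl | hu
      · exact hWX hw
      · exact hWX' hu
  obtain ⟨u, hu, hwu⟩ := hadj
  have hwX : w ∉ X := (hWX hw).1
  have huX : u ∉ X := (hWX' hu).1
  obtain ⟨m1, m2, m3⟩ := hC.mem_verts_of_reachable (W := (W' : Set V)) (X := (X : Set V))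
    hx' huX hwW' hwX hwx' hwu (hreach u hu)
  have hxw : x' ≠ w := fun h => hwX (h ▸ hx')
  have hxu : x' ≠ u := fun h => huX (h ▸ hx')
  have hverts : (({x', w, u} : Finset V) : Set V) = C.verts := by
    refine Set.eq_of_subset_of_ncard_le ?_ ?_ (Set.toFinite _)
    · intro a ha
      simp only [Finset.coe_insert, Finset.coe_singleton, Set.mem_insert_iff,
        Set.mem_singleton_iff] at ha
      rcases ha with rfl | rfl | rfl
      exacts [m1, m2, m3]
    · rw [h3, Set.ncard_coe_finset, Finset.card_eq_three.2 ⟨x', w, u, hxw, hxu, hwu.ne, rfl⟩]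
  refine ⟨x', hx', hxx, fun y hy => ⟨fun hyC => ?_, fun h => h ▸ m1⟩⟩
  rw [← hverts] at hyC
  simp only [Finset.coe_insert, Finset.coe_singleton, Set.mem_insert_iff,
    Set.mem_singleton_iff] at hyC
  rcases hyC with h | rfl | rfl
  · exact h
  · exact absurd hy hwX
  · exact absurd hy huX

lemma IsUniqueCycle.accessible_of_triangle [Finite V] {C : G.Subgraph} (hC : IsUniqueCycle C)
    (h3 : C.verts.ncard = 3) {X : Finset V} (hX : IsLocalMaxStable G X) (hne : X.Nonempty) :
    ∃ x ∈ X, IsLocalMaxStable G (X.erase x) := by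
  by_contra! hbad
  obtain ⟨x, hx⟩ := hne
  obtain ⟨x', hx', -, h1⟩ := hC.exists_ne_mem_verts_of_inaccessible h3 hX hbad hx
  obtain ⟨x'', hx'', hne, h2⟩ := hC.exists_ne_mem_verts_of_inaccessible h3 hX hbad hx'
  exact hne ((h1 x'' hx'').1 ((h2 x'' hx'').2 rfl))

end Accessibility

end UnicycleGreedoid

open UnicycleGreedoid in
theorem mainTheorem1 {V : Type*} [Finite V] (G : SimpleGraph V) (C : G.Subgraph)
    (hC : IsUniqueCycle C) (k : ℕ) (hk : C.verts.ncard = k) :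
    (k = 3 → IsGreedoid (localMaxStableSets G)) ∧
    (Even k → 4 ≤ k →
      (IsGreedoid (localMaxStableSets G) ↔
        ∀ M : G.Subgraph, IsMaximumMatching M → IsUniquelyRestricted M)) ∧
    (Odd k → 5 ≤ k →
      (IsGreedoid (localMaxStableSets G) ↔
        ∀ S ∈ localMaxStableSets G, IsKonigEgervary (G.induce (closedNbhd G (S : Set V))))) := by
  subst hk
  rw [isGreedoid_iff_accessible]
  refine ⟨fun h3 X hX hne => hC.accessible_of_triangle h3 hX hne, fun heven _ => ?_,
    fun hodd h5 => ?_⟩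
  · obtain ⟨c⟩ := hC.nonempty_coloring heven
    exact ⟨fun hacc M hM => isUniquelyRestricted_of_accessible c hacc hM,
      fun hur X hX hne => accessible_of_isUniquelyRestricted c hur X hX hne⟩
  · have h3 : C.verts.ncard ≠ 3 := by omega
    constructor
    · intro hacc S hS
      exact (isKonigEgervary_induce_iff hS).2
        (hallNbhd_of_accessible (hC.triangle_free h3) hacc S hS)
    · intro hKE X hX hne
      exact hC.accessible_of_hallNbhd hodd hX ((isKonigEgervary_induce_iff hX).1 (hKE X hX)) hne
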